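/- Let $V\subset H=H'\subset V'$ be a Gelfand triple of complex Hilbert spaces (the embedding $V\hookrightarrow H$ is continuous and dense; $V'$ is the space of bounded antilinear functionals on $V$), let $\|\cdot\|$ be the norm of $H$, and let $A:V\to V'$ be a bounded self-adjoint operator with $\beta_0\|u\|_V^2\le\langle Au,u\rangle\le\beta_1\|u\|_V^2$ for all $u\in V$, where $\beta_1>\beta_0>0$. Let $\alpha\in(0,1)$, $k\in\{1,\dots,6\}$, $T>0$, $N\ge 2$, $\tau=T/N$, $t_n=n\tau$. Let $\omega_j^{(\alpha)}$ be the coefficients of the power series $\delta_k(\xi)^\alpha=\sum_{j\ge0}\omega_j^{(\alpha)}\xi^j$ at $0$, with $\delta_k(\xi)=\sum_{\ell=1}^k\frac1\ell(1-\xi)^\ell$, and put $\bar\partial_\tau^\alpha W^n=\tau^{-\alpha}\sum_{j=0}^\infty\omega_j^{(\alpha)}W^{n-j}$. Given an arbitrary initial guess $U_0^1,\dots,U_0^N\in H$, let $U_m^n$, $m\ge1$, be a solution of the homogeneous iteration with relaxation parameter $\kappa>0$: $U_m^n\in V$ for $1\le n\le N$ and $$\bar\partial_\tau^\alpha U_m^n+AU_m^n=0\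 \text{ in } V'\quad(1\le n\le N),$$ $$U_m^{-n}=\kappa\,(U_m^{N-n}-U_{m-1}^{N-n})\quad(0\le n\le N-1),\qquad U_m^n=0\quad(n\le -N).$$ Then there are constants $C,c>0$, depending only on $\alpha$, $k$, $\beta_0$ and $T$, such that for every $\kappa_0>0$ with $C\kappa_0<\frac12$ the choice $\kappa=\kappa_0/\log N$ gives, for all $m\ge1$ and all $1\le n\le N$, $$\|U_m^n\|\le c\,t_n^{\alpha-1}\,\gamma(\kappa)^m\Big(\tau\sum_{j=1}^N t_j^{-\alpha}\,\|U_0^{N-j+1}\|\Big),\qquad \gamma(\kappa)=\frac{C\kappa\log N}{1-C\kappa\log N}=\frac{C\kappa_0}{1-C\kappa_0}\in(0,1).$$ In particular $c$ and $\gamma(\kappa)$ are independent of $\tau$, $N$, $n$ and $m$. -/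

import Mathlib

/-- The generating polynomial `δ_k(ξ) = ∑_{ℓ=1}^k (1 - ξ)^ℓ / ℓ` of the `k`-step backward
differentiation formula. -/
noncomputable def bdfGen (k : ℕ) (ξ : ℂ) : ℂ :=
  ∑ l ∈ Finset.Icc 1 k, (1 / (l : ℂ)) * (1 - ξ) ^ l

/-- The convolution quadrature weights `ω_j^{(α)}`: the Taylor coefficients at `0` of
`ξ ↦ δ_k(ξ)^α`. As `δ_k(0) > 0` for `k ≥ 1`, the principal power is analytic near `0`. -/
noncomputable def cqWeight (k : ℕ) (α : ℝ) (j : ℕ) : ℂ :=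
  iteratedDeriv j (fun ξ : ℂ => bdfGen k ξ ^ (α : ℂ)) 0 / (Nat.factorial j : ℂ)

/-- The discrete fractional derivative
`τ^{-α} ∑_{j=0}^∞ ω_j^{(α)} W^{n-j}` of a sequence `W` indexed by `ℤ`. -/
noncomputable def cqDeriv {H : Type*} [NormedAddCommGroup H] [InnerProductSpace ℂ H]
    (k : ℕ) (α τ : ℝ) (W : ℤ → H) (n : ℤ) : H :=
  (((τ ^ α)⁻¹ : ℝ) : ℂ) • ∑' j : ℕ, cqWeight k α j • W (n - (j : ℤ))

/-- `ι : V → H` is the embedding of a Gelfand triple `V ⊂ H = H' ⊂ V'`: it is continuous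
(being a continuous linear map), injective, and has dense range. The space `V'` consists of
the bounded antilinear functionals on `V`, and `w ∈ H` is identified with the functional
`φ ↦ (w, ι φ)_H`, the inner product on `H` being linear in `w`; in Mathlib's order of arguments
this is `inner ℂ (ι φ) w`. -/
structure IsGelfandEmbedding {H V : Type*} [NormedAddCommGroup H] [InnerProductSpace ℂ H]
    [NormedAddCommGroup V] [InnerProductSpace ℂ V] (ι : V →L[ℂ] H) : Prop where
  injective : Function.Injective ι
  denseRange : DenseRange ι

/-- A bounded operator `A : V → V'` that is self-adjoint and elliptic with constants
`β₀` and `β₁`. -/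
structure IsSelfAdjointElliptic {V : Type*} [NormedAddCommGroup V] [InnerProductSpace ℂ V]
    (A : V →L[ℂ] (V →L⋆[ℂ] ℂ)) (β₀ β₁ : ℝ) : Prop where
  selfAdjoint : ∀ u w : V, A u w = (starRingEnd ℂ) (A w u)
  lower : ∀ u : V, β₀ * ‖u‖ ^ 2 ≤ (A u u).re
  upper : ∀ u : V, (A u u).re ≤ β₁ * ‖u‖ ^ 2

/-- `U m n` (`m` the iteration number, `n` the time level) is generated by the iterative
parallel-in-time convolution quadrature scheme with step size `τ`, `N` time steps, relaxation
parameter `κ`, initial value `v` and source terms `F n ∈ V'`. The initial guess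
`U 0 1, …, U 0 N` is arbitrary. For each `m ≥ 1`:
* for `1 ≤ n ≤ N`, `U m n` lies in `V` and `∂̄_τ^α U_m^n + A U_m^n = F_n` in `V'`;
* `U_m^{-n} = v + κ (U_m^{N-n} - U_{m-1}^{N-n})` for `0 ≤ n ≤ N - 1`;
* `U_m^n = v` for `n ≤ -N`. -/
structure IsCQIteration {H V : Type*} [NormedAddCommGroup H] [InnerProductSpace ℂ H]
    [NormedAddCommGroup V] [InnerProductSpace ℂ V]
    (ι : V →L[ℂ] H) (A : V →L[ℂ] (V →L⋆[ℂ] ℂ)) (k : ℕ) (α τ : ℝ) (N : ℕ) (κ : ℝ)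
    (v : H) (F : ℕ → (V →L⋆[ℂ] ℂ)) (U : ℕ → ℤ → H) : Prop where
  scheme : ∀ m : ℕ, 1 ≤ m → ∀ n : ℕ, 1 ≤ n → n ≤ N →
    ∃ u : V, ι u = U m (n : ℤ) ∧
      ∀ φ : V, inner ℂ (ι φ) (cqDeriv k α τ (U m) (n : ℤ)) + A u φ = F n φ
  history : ∀ m : ℕ, 1 ≤ m → ∀ n : ℕ, n < N →
    U m (-(n : ℤ)) = v + (κ : ℂ) • (U m ((N : ℤ) - n) - U (m - 1) ((N : ℤ) - n))
  past : ∀ m : ℕ, 1 ≤ m → ∀ n : ℤ, n ≤ -(N : ℤ) → U m n = v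

/-! Let `B = ι A⁻¹ ι*`, a positive operator on `H`. The scheme says `U^n = -B ∂̄_τ^α U^n`, a
discrete Volterra equation for the positive times whose source `g` is the contribution of the
history, the times `-i` with `0 ≤ i < N`. Its solution is the convolution of `-g` with the Taylor
coefficients of `b (1 + b δ_k^α)⁻¹`, evaluated at `b = τ^{-α} B` by the functional calculus.

Two coefficient bounds carry the proof. The weights satisfy `|ω_j| ≤ C j^{-1-α}`
(`exists_norm_cqWeight_le`), and the coefficients of `b (1 + b δ_k^α)⁻¹` are at most `C (n+1)^{α-1}`
uniformly in `b ≥ 0` (`exists_norm_mul_resolventCoeff_le`); this uniformity removes `τ`, `A` and the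
spaces from the constants. Both come from Cauchy's formula on a circle at distance about `1/n` from
the singularity at `1`. They require that `δ_k` avoid the negative real axis and zero on the closed
disc except at `1`, which a Routh array gives for each `k ≤ 6`.

The history at time `-i` is `κ` times a difference of two iterates at time `N-i`. With `S_m = ∑
(i+1)^{-α} ‖U_m^{N-i}‖` (`historyNorm`), convolving the two bounds gives `‖U_m^n‖ ≤ Cκ n^{α-1} (S_m
+ S_{m-1})` (`exists_norm_iterate_le`). Summing this against the weights of `S_m` produces a
discrete Beta integral, bounded independently of `N`, so that `S_m ≤ x (S_m + S_{m-1})` with `x <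
1/2`. Absorbing `S_m` gives `S_m ≤ γ S_{m-1}` with `γ = x / (1 - x) < 1`, and the pointwise bound
follows. -/

open MeasureTheory Metric

/-! ### ### Location of the values of `δ_k`: Routh arrays -/

/-- Consecutive rows of a Routh array, evaluated at a point `w` with `0 ≤ re w`. -/
structure RouthPair (x y : ℂ) : Prop where
  re_nonneg : 0 ≤ (x * (starRingEnd ℂ) y).re
  ne_zero : x ≠ 0 ∨ y ≠ 0

namespace RouthPair

theorem base {w : ℂ} (hw : 0 ≤ w.re) : RouthPair w 1 :=
  ⟨by simpa using hw, Or.inr one_ne_zero⟩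

/-- Multiplying the recursion by `conj y` gives `c re(x conj y) = a re(w) |y|² + g re(y conj z)`, so
nonnegativity passes up the array. As `a = 0` is allowed, the leading coefficient may vanish at `s =
0`. -/
theorem step {x y z w : ℂ} {a c g : ℝ} (h : RouthPair y z) (hw : 0 ≤ w.re) (hc : 0 < c)
    (ha : 0 ≤ a) (hg : 0 < g) (e : (c : ℂ) * x = a * w * y + g * z) : RouthPair x y := by
  have h0 := h.re_nonneg
  constructor
  · have key : c * (x * (starRingEnd ℂ) y).re =
        a * w.re * Complex.normSq y + g * (y * (starRingEnd ℂ) z).re := by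
      have e1 := congrArg Complex.re e
      have e2 := congrArg Complex.im e
      simp only [Complex.mul_re, Complex.mul_im, Complex.add_re, Complex.add_im,
        Complex.ofReal_re, Complex.ofReal_im, Complex.conj_re, Complex.conj_im,
        Complex.normSq_apply] at e1 e2 ⊢
      linear_combination y.re * e1 + y.im * e2
    have : 0 ≤ c * (x * (starRingEnd ℂ) y).re := by
      rw [key]
      have := Complex.normSq_nonneg y
      positivity
    exact nonneg_of_mul_nonneg_right this hc
  · by_contra! hxy
    obtain ⟨rfl, rfl⟩ := hxy
    have hz : z = 0 := by
      have : (g : ℂ) ≠ 0 := by exact_mod_cast hg.ne'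
      simpa [this] using e
    exact h.ne_zero.elim (fun h => h rfl) (fun h => h hz)

theorem add_ne_zero {x y : ℂ} (h : RouthPair x y) : x + y ≠ 0 := by
  intro e
  obtain rfl : x = -y := eq_neg_of_add_eq_zero_left e
  have h0 := h.re_nonneg
  rw [neg_mul, Complex.mul_conj, Complex.neg_re, Complex.ofReal_re] at h0
  have hy : y = 0 := Complex.normSq_eq_zero.1 (le_antisymm (by linarith) (Complex.normSq_nonneg y))
  have := h.ne_zero
  simp [hy] at this

end RouthPair

/-- Here and in the next five lemmas the polynomial is `(w + 1)^k (δ_k + s)` at `1 - ξ = 2 / (w +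
1)`, cleared of denominators. From `k = 2` on it is split into its even and odd parts in `w`, the
first two rows of the Routh array. The array is climbed from the bottom; common factors of a row are
moved into `g`, and every entry is a polynomial in `s` with nonnegative coefficients. -/
theorem bdfGenOne_add_ne_zero {w : ℂ} (hw : 0 ≤ w.re) {s : ℝ} (hs : 0 ≤ s) :
    s * w + (s + 2) ≠ (0 : ℂ) := by
  intro h
  have e := congrArg Complex.re h
  simp at e
  have := mul_nonneg hs hw
  linarith

theorem bdfGenTwo_add_ne_zero {w : ℂ} (hw : 0 ≤ w.re) {s : ℝ} (hs : 0 ≤ s) :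
    s * w ^ 2 + (s + 4) +
      ((2 * s + 2) * w) ≠ (0 : ℂ) := by
  have h1 : RouthPair ((2 * s + 2) * w) 1 := .base (by
    simp only [Complex.mul_re, Complex.add_re, Complex.add_im, Complex.mul_im, Complex.ofReal_re,
      Complex.ofReal_im, Complex.re_ofNat, Complex.im_ofNat]
    ring_nf
    positivity)
  have h2 : RouthPair (s * w ^ 2 + (s + 4))
      ((2 * s + 2) * w) :=
    h1.step hw (c := 2 * s + 2) (a := s)
      (g := (2 * s + 2) * (s + 4))
      (by positivity) (by positivity) (by positivity) (by push_cast; ring)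
  exact h2.add_ne_zero

theorem bdfGenThree_add_ne_zero {w : ℂ} (hw : 0 ≤ w.re) {s : ℝ} (hs : 0 ≤ s) :
    3 * s * w ^ 3 + (9 * s + 18) * w +
      ((9 * s + 6) * w ^ 2 + (3 * s + 20)) ≠ (0 : ℂ) := by
  have h1 : RouthPair w 1 := .base hw
  have h2 : RouthPair ((9 * s + 6) * w ^ 2 + (3 * s + 20))
      w :=
    h1.step hw (c := 1) (a := 9 * s + 6)
      (g := 3 * s + 20)
      (by positivity) (by positivity) (by positivity) (by push_cast; ring)
  have h3 : RouthPair (3 * s * w ^ 3 + (9 * s + 18) * w)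
      ((9 * s + 6) * w ^ 2 + (3 * s + 20)) :=
    h2.step hw (c := 9 * s + 6) (a := 3 * s)
      (g := 72 * s ^ 2 + 156 * s + 108)
      (by positivity) (by positivity) (by positivity) (by push_cast; ring)
  exact h3.add_ne_zero

theorem bdfGenFour_add_ne_zero {w : ℂ} (hw : 0 ≤ w.re) {s : ℝ} (hs : 0 ≤ s) :
    3 * s * w ^ 4 + (18 * s + 24) * w ^ 2 + (3 * s + 32) +
      ((12 * s + 6) * w ^ 3 + (12 * s + 38) * w) ≠ (0 : ℂ) := by
  have h1 : RouthPair w 1 := .base hw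
  have h2 : RouthPair ((30 * s ^ 2 + 47 * s + 24) * w ^ 2 + (6 * s ^ 2 + 67 * s + 32))
      w :=
    h1.step hw (c := 1) (a := 30 * s ^ 2 + 47 * s + 24)
      (g := 6 * s ^ 2 + 67 * s + 32)
      (by positivity) (by positivity) (by positivity) (by push_cast; ring)
  have h3 : RouthPair ((12 * s + 6) * w ^ 3 + (12 * s + 38) * w)
      ((30 * s ^ 2 + 47 * s + 24) * w ^ 2 + (6 * s ^ 2 + 67 * s + 32)) :=
    h2.step hw (c := 30 * s ^ 2 + 47 * s + 24) (a := 12 * s + 6)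
      (g := 288 * s ^ 3 + 864 * s ^ 2 + 1288 * s + 720)
      (by positivity) (by positivity) (by positivity) (by push_cast; ring)
  have h4 : RouthPair (3 * s * w ^ 4 + (18 * s + 24) * w ^ 2 + (3 * s + 32))
      ((12 * s + 6) * w ^ 3 + (12 * s + 38) * w) :=
    h3.step hw (c := 12 * s + 6) (a := 3 * s)
      (g := 6)
      (by positivity) (by positivity) (by positivity) (by push_cast; ring)
  exact h4.add_ne_zero

theorem bdfGenFive_add_ne_zero {w : ℂ} (hw : 0 ≤ w.re) {s : ℝ} (hs : 0 ≤ s) :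
    15 * s * w ^ 5 + (150 * s + 150) * w ^ 3 + (75 * s + 350) * w +
      ((75 * s + 30) * w ^ 4 + (150 * s + 310) * w ^ 2 + (15 * s + 256)) ≠ (0 : ℂ) := by
  have h1 : RouthPair w 1 := .base hw
  have h2 : RouthPair ((3150 * s ^ 3 + 8145 * s ^ 2 + 8629 * s + 3600) * w ^ 2 + (450 * s ^ 3 +
          8235 * s ^ 2 + 9697 * s + 3840))
      w :=
    h1.step hw (c := 1) (a := 3150 * s ^ 3 + 8145 * s ^ 2 + 8629 * s + 3600)
      (g := 450 * s ^ 3 + 8235 * s ^ 2 + 9697 * s + 3840)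
      (by positivity) (by positivity) (by positivity) (by push_cast; ring)
  have h3 : RouthPair ((150 * s ^ 2 + 185 * s + 75) * w ^ 3 + (90 * s ^ 2 + 411 * s + 175) * w)
      ((3150 * s ^ 3 + 8145 * s ^ 2 + 8629 * s + 3600) * w ^ 2 + (450 * s ^ 3 + 8235 * s ^ 2 +
          9697 * s + 3840)) :=
    h2.step hw (c := 3150 * s ^ 3 + 8145 * s ^ 2 + 8629 * s + 3600) (a := 150 * s ^ 2 +
          185 * s + 75)
      (g := 216000 * s ^ 5 + 709200 * s ^ 4 + 1663680 * s ^ 3 + 2308324 * s ^ 2 + 1552000 * s +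
          342000)
      (by positivity) (by positivity) (by positivity) (by push_cast; ring)
  have h4 : RouthPair ((75 * s + 30) * w ^ 4 + (150 * s + 310) * w ^ 2 + (15 * s + 256))
      ((150 * s ^ 2 + 185 * s + 75) * w ^ 3 + (90 * s ^ 2 + 411 * s + 175) * w) :=
    h3.step hw (c := 150 * s ^ 2 + 185 * s + 75) (a := 75 * s + 30)
      (g := 5)
      (by positivity) (by positivity) (by positivity) (by push_cast; ring)
  have h5 : RouthPair (15 * s * w ^ 5 + (150 * s + 150) * w ^ 3 + (75 * s + 350) * w)
      ((75 * s + 30) * w ^ 4 + (150 * s + 310) * w ^ 2 + (15 * s + 256)) :=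
    h4.step hw (c := 75 * s + 30) (a := 15 * s)
      (g := 60)
      (by positivity) (by positivity) (by positivity) (by push_cast; ring)
  exact h5.add_ne_zero

theorem bdfGenSix_add_ne_zero {w : ℂ} (hw : 0 ≤ w.re) {s : ℝ} (hs : 0 ≤ s) :
    15 * s * w ^ 6 + (225 * s + 180) * w ^ 4 + (225 * s + 660) * w ^ 2 + (15 * s + 416) +
      ((90 * s + 30) * w ^ 5 + (300 * s + 460) * w ^ 3 + (90 * s + 606) * w) ≠ (0 : ℂ) := by
  have h1 : RouthPair w 1 := .base hw
  have h2 : RouthPair ((340200 * s ^ 4 + 1304910 * s ^ 3 + 2097657 * s ^ 2 + 1726425 * s +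
          604800) * w ^ 2 + (37800 * s ^ 4 + 1127790 * s ^ 3 + 2272833 * s ^ 2 + 1933481 * s +
          655200))
      w :=
    h1.step hw (c := 1) (a := 340200 * s ^ 4 + 1304910 * s ^ 3 + 2097657 * s ^ 2 +
          1726425 * s + 604800)
      (g := 37800 * s ^ 4 + 1127790 * s ^ 3 + 2272833 * s ^ 2 + 1933481 * s + 655200)
      (by positivity) (by positivity) (by positivity) (by push_cast; ring)
  have h3 : RouthPair ((2520 * s ^ 3 + 5298 * s ^ 2 + 4591 * s + 1575) * w ^ 3 +
          (1080 * s ^ 3 + 6282 * s ^ 2 + 6627 * s + 2415) * w)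
      ((340200 * s ^ 4 + 1304910 * s ^ 3 + 2097657 * s ^ 2 + 1726425 * s + 604800) * w ^ 2 +
          (37800 * s ^ 4 + 1127790 * s ^ 3 + 2272833 * s ^ 2 + 1933481 * s + 655200)) :=
    h2.step hw (c := 340200 * s ^ 4 + 1304910 * s ^ 3 + 2097657 * s ^ 2 + 1726425 * s +
          604800) (a := 2520 * s ^ 3 + 5298 * s ^ 2 + 4591 * s + 1575)
      (g := 272160000 * s ^ 7 + 504144000 * s ^ 6 + 841309200 * s ^ 5 + 2360181600 * s ^ 4 +
          4445584548 * s ^ 3 + 4378640884 * s ^ 2 + 2124070200 * s + 428652000)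
      (by positivity) (by positivity) (by positivity) (by push_cast; ring)
  have h4 : RouthPair ((525 * s ^ 2 + 535 * s + 180) * w ^ 4 + (630 * s ^ 2 + 1902 * s +
          660) * w ^ 2 + (45 * s ^ 2 + 1263 * s + 416))
      ((2520 * s ^ 3 + 5298 * s ^ 2 + 4591 * s + 1575) * w ^ 3 + (1080 * s ^ 3 + 6282 * s ^ 2 +
          6627 * s + 2415) * w) :=
    h3.step hw (c := 2520 * s ^ 3 + 5298 * s ^ 2 + 4591 * s + 1575) (a := 525 * s ^ 2 +
          535 * s + 180)
      (g := 3 * s + 1)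
      (by positivity) (by positivity) (by positivity) (by push_cast; ring)
  have h5 : RouthPair ((90 * s + 30) * w ^ 5 + (300 * s + 460) * w ^ 3 + (90 * s + 606) * w)
      ((525 * s ^ 2 + 535 * s + 180) * w ^ 4 + (630 * s ^ 2 + 1902 * s + 660) * w ^ 2 +
          (45 * s ^ 2 + 1263 * s + 416)) :=
    h4.step hw (c := 525 * s ^ 2 + 535 * s + 180) (a := 90 * s + 30)
      (g := 40)
      (by positivity) (by positivity) (by positivity) (by push_cast; ring)
  have h6 : RouthPair (15 * s * w ^ 6 + (225 * s + 180) * w ^ 4 + (225 * s + 660) * w ^ 2 +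
          (15 * s + 416))
      ((90 * s + 30) * w ^ 5 + (300 * s + 460) * w ^ 3 + (90 * s + 606) * w) :=
    h5.step hw (c := 90 * s + 30) (a := 15 * s)
      (g := 30)
      (by positivity) (by positivity) (by positivity) (by push_cast; ring)
  exact h6.add_ne_zero

/-- The region of instability of the `k`-step backward differentiation formula, `k ≤ 6`,
does not meet the negative real axis. -/
theorem bdfGen_add_ne_zero {k : ℕ} (hk1 : 1 ≤ k) (hk6 : k ≤ 6) {ξ : ℂ} (hξ : ‖ξ‖ ≤ 1)
    (hξ1 : ξ ≠ 1) {s : ℝ} (hs : 0 ≤ s) : bdfGen k ξ + s ≠ 0 := by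
  have hz : 1 - ξ ≠ 0 := sub_ne_zero.2 hξ1.symm
  -- The Cayley transform sends the closed disc without `1` to the closed right half-plane, and `1 -
  -- ξ = 2 / (w + 1)` turns `δ_k + s` into a polynomial in `w` after multiplication by `(w + 1)^k`.
  obtain ⟨w, hwdef⟩ : ∃ w : ℂ, w = (1 + ξ) / (1 - ξ) := ⟨_, rfl⟩
  have hw : 0 ≤ w.re := by
    have h1 : ‖ξ‖ ^ 2 ≤ 1 := pow_le_one₀ (norm_nonneg _) hξ
    rw [Complex.sq_norm, Complex.normSq_apply] at h1
    rw [hwdef, Complex.div_re, ← add_div]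
    apply div_nonneg _ (Complex.normSq_nonneg _)
    simp
    nlinarith
  have hu : (w + 1) * (1 - ξ) = 2 := by rw [hwdef]; field_simp; ring
  have hp : ∀ l : ℕ, (w + 1) ^ l * (1 - ξ) ^ l = 2 ^ l := fun l => by rw [← mul_pow, hu]
  intro h
  interval_cases k <;> simp only [bdfGen, Finset.sum_Icc_succ_top, Nat.reduceLeDiff,
    Nat.reduceAdd, Finset.Icc_self, Finset.sum_singleton, Nat.cast_ofNat, Nat.cast_one] at h
  · refine bdfGenOne_add_ne_zero hw hs ?_
    linear_combination 1 * (w + 1) ^ 1 * h -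
      1 / 1 * (w + 1) ^ 0 * hp 1
  · refine bdfGenTwo_add_ne_zero hw hs ?_
    linear_combination 1 * (w + 1) ^ 2 * h -
      1 / 1 * (w + 1) ^ 1 * hp 1 -
      1 / 2 * (w + 1) ^ 0 * hp 2
  · refine bdfGenThree_add_ne_zero hw hs ?_
    linear_combination 3 * (w + 1) ^ 3 * h -
      3 / 1 * (w + 1) ^ 2 * hp 1 -
      3 / 2 * (w + 1) ^ 1 * hp 2 -
      3 / 3 * (w + 1) ^ 0 * hp 3
  · refine bdfGenFour_add_ne_zero hw hs ?_
    linear_combination 3 * (w + 1) ^ 4 * h -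
      3 / 1 * (w + 1) ^ 3 * hp 1 -
      3 / 2 * (w + 1) ^ 2 * hp 2 -
      3 / 3 * (w + 1) ^ 1 * hp 3 -
      3 / 4 * (w + 1) ^ 0 * hp 4
  · refine bdfGenFive_add_ne_zero hw hs ?_
    linear_combination 15 * (w + 1) ^ 5 * h -
      15 / 1 * (w + 1) ^ 4 * hp 1 -
      15 / 2 * (w + 1) ^ 3 * hp 2 -
      15 / 3 * (w + 1) ^ 2 * hp 3 -
      15 / 4 * (w + 1) ^ 1 * hp 4 -
      15 / 5 * (w + 1) ^ 0 * hp 5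
  · refine bdfGenSix_add_ne_zero hw hs ?_
    linear_combination 15 * (w + 1) ^ 6 * h -
      15 / 1 * (w + 1) ^ 5 * hp 1 -
      15 / 2 * (w + 1) ^ 4 * hp 2 -
      15 / 3 * (w + 1) ^ 3 * hp 3 -
      15 / 4 * (w + 1) ^ 2 * hp 4 -
      15 / 5 * (w + 1) ^ 1 * hp 5 -
      15 / 6 * (w + 1) ^ 0 * hp 6

/-! ### Taylor coefficients of functions with a singularity at `1` -/

theorem norm_one_sub_circleMap_sq (r θ : ℝ) :
    ‖1 - circleMap 0 r θ‖ ^ 2 = (1 - r) ^ 2 + 4 * r * Real.sin (θ / 2) ^ 2 := by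
  have h : Real.cos θ = 1 - 2 * Real.sin (θ / 2) ^ 2 := by
    have := Real.cos_two_mul (θ / 2)
    rw [mul_div_cancel₀ θ two_ne_zero] at this
    nlinarith [Real.sin_sq_add_cos_sq (θ / 2)]
  rw [Complex.sq_norm, Complex.normSq_apply]
  simp only [circleMap, zero_add, Complex.sub_re, Complex.sub_im, Complex.one_re, Complex.one_im,
    Complex.re_ofReal_mul, Complex.im_ofReal_mul, Complex.exp_ofReal_mul_I_re,
    Complex.exp_ofReal_mul_I_im]
  have h2 := Real.sin_sq_add_cos_sq θ
  linear_combination r ^ 2 * h2 - 2 * r * h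

/-- Used with `t` the angular distance of `θ` to `0` or to `2π`, whichever is smaller; Jordan's
inequality then supplies `ht`. -/
theorem le_norm_one_sub_circleMap {r θ t : ℝ} (hr : 1 / 2 ≤ r) (ht0 : 0 ≤ t)
    (ht : t ≤ Real.pi * Real.sin (θ / 2)) :
    (1 - r + t) / Real.pi ≤ ‖1 - circleMap 0 r θ‖ := by
  have hpi := Real.pi_gt_three
  refine le_of_sq_le_sq ?_ (norm_nonneg _)
  rw [norm_one_sub_circleMap_sq, div_pow, div_le_iff₀ (by positivity)]
  have h1 : t ^ 2 ≤ Real.pi ^ 2 * Real.sin (θ / 2) ^ 2 := by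
    rw [← mul_pow]; exact pow_le_pow_left₀ ht0 ht 2
  have h2 : 2 * (Real.pi ^ 2 * Real.sin (θ / 2) ^ 2) ≤
      4 * r * (Real.pi ^ 2 * Real.sin (θ / 2) ^ 2) := by
    gcongr; linarith
  have h3 : 2 * (1 - r) ^ 2 ≤ Real.pi ^ 2 * (1 - r) ^ 2 := by
    gcongr; nlinarith
  nlinarith [sq_nonneg (1 - r - t)]

theorem norm_one_sub_circleMap_rpow_le {p r θ : ℝ} (hp : 0 ≤ p) (hr : 1 / 2 ≤ r) (hr1 : r < 1)
    (h0 : 0 ≤ θ) (h1 : θ ≤ 2 * Real.pi) :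
    ‖1 - circleMap 0 r θ‖ ^ (-p) ≤
      Real.pi ^ p * ((1 - r + θ) ^ (-p) + (1 - r + 2 * Real.pi - θ) ^ (-p)) := by
  have hpi := Real.pi_pos
  have key : ∀ t, 0 ≤ t → t ≤ Real.pi * Real.sin (θ / 2) →
      ‖1 - circleMap 0 r θ‖ ^ (-p) ≤ Real.pi ^ p * (1 - r + t) ^ (-p) := fun t ht0 ht => by
    have hpos : 0 < 1 - r + t := by linarith
    calc ‖1 - circleMap 0 r θ‖ ^ (-p) ≤ ((1 - r + t) / Real.pi) ^ (-p) :=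
          Real.rpow_le_rpow_of_nonpos (by positivity)
            (le_norm_one_sub_circleMap hr ht0 ht) (by linarith)
      _ = Real.pi ^ p * (1 - r + t) ^ (-p) := by
          rw [Real.div_rpow hpos.le hpi.le, Real.rpow_neg hpi.le, div_inv_eq_mul, mul_comm]
  have hpos : 0 < 1 - r + 2 * Real.pi - θ := by linarith
  have hpos' : 0 < 1 - r + θ := by linarith
  rcases le_total θ Real.pi with h | h
  · refine (key θ h0 ?_).trans ?_
    · have := Real.mul_le_sin (x := θ / 2) (by linarith) (by linarith)
      calc θ = Real.pi * (2 / Real.pi * (θ / 2)) := by field_simp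
        _ ≤ _ := by gcongr
    · gcongr
      exact le_add_of_nonneg_right (by positivity)
  · refine (key (2 * Real.pi - θ) (by linarith) ?_).trans ?_
    · have := Real.mul_le_sin (x := Real.pi - θ / 2) (by linarith) (by linarith)
      rw [Real.sin_pi_sub] at this
      calc 2 * Real.pi - θ = Real.pi * (2 / Real.pi * (Real.pi - θ / 2)) := by field_simp
        _ ≤ _ := by gcongr
    · rw [← add_sub_assoc]
      gcongr
      exact le_add_of_nonneg_left (by positivity)

theorem integral_add_rpow_neg_le {p ε b : ℝ} (hp : 1 < p) (hε : 0 < ε) (hb : 0 ≤ b) :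
    ∫ θ in (0 : ℝ)..b, (ε + θ) ^ (-p) ≤ ε ^ (1 - p) / (p - 1) := by
  rw [intervalIntegral.integral_comp_add_left (fun x => x ^ (-p)), add_zero,
    integral_rpow (Or.inr ⟨by linarith, by
      rw [Set.uIcc_of_le (by linarith)]; exact fun h => by linarith [h.1]⟩)]
  have : 0 < (ε + b) ^ (-p + 1) := by positivity
  rw [show -p + 1 = -(p - 1) by ring, div_neg, ← neg_div, show 1 - p = -(p - 1) by ring]
  have : 0 < (ε + b) ^ (-(p - 1)) := by positivity
  have : 0 < p - 1 := by linarith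
  gcongr
  linarith

theorem continuousOn_add_rpow {p ε b : ℝ} (hε : 0 < ε) (hb : 0 ≤ b) :
    ContinuousOn (fun θ : ℝ => (ε + θ) ^ (-p)) (Set.uIcc 0 b) := by
  rw [Set.uIcc_of_le hb]
  refine ContinuousOn.rpow_const (by fun_prop) fun x hx => Or.inl ?_
  linarith [hx.1]

theorem integral_norm_one_sub_circleMap_rpow_le {p r : ℝ} (hp : 1 < p) (hr : 1 / 2 ≤ r)
    (hr1 : r < 1) {g : ℝ → ℝ} (hg : Continuous g) {M : ℝ} (hM : 0 ≤ M)
    (hgM : ∀ θ, g θ ≤ M * ‖1 - circleMap 0 r θ‖ ^ (-p)) :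
    ∫ θ in (0 : ℝ)..2 * Real.pi, g θ ≤
      M * (Real.pi ^ p * (2 * (1 - r) ^ (1 - p) / (p - 1))) := by
  have hpi := Real.pi_pos
  have hb : 0 ≤ 2 * Real.pi := by linarith
  have hε : 0 < 1 - r := by linarith
  have i1 : IntervalIntegrable (fun θ : ℝ => (1 - r + θ) ^ (-p)) volume 0 (2 * Real.pi) :=
    (continuousOn_add_rpow hε hb).intervalIntegrable
  have i2 : IntervalIntegrable (fun θ : ℝ => (1 - r + 2 * Real.pi - θ) ^ (-p)) volume 0
      (2 * Real.pi) := by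
    have := (i1.comp_sub_left (2 * Real.pi)).symm
    simpa only [sub_self, sub_zero, ← add_sub_assoc] using this
  have e2 : ∫ θ in (0 : ℝ)..2 * Real.pi, (1 - r + 2 * Real.pi - θ) ^ (-p) =
      ∫ θ in (0 : ℝ)..2 * Real.pi, (1 - r + θ) ^ (-p) := by
    have := intervalIntegral.integral_comp_sub_left (a := 0) (b := 2 * Real.pi)
      (fun θ : ℝ => (1 - r + θ) ^ (-p)) (2 * Real.pi)
    simpa only [sub_self, sub_zero, ← add_sub_assoc] using this
  have e1 := integral_add_rpow_neg_le hp hε hb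
  calc ∫ θ in (0 : ℝ)..2 * Real.pi, g θ
      ≤ ∫ θ in (0 : ℝ)..2 * Real.pi, M * (Real.pi ^ p *
          ((1 - r + θ) ^ (-p) + (1 - r + 2 * Real.pi - θ) ^ (-p))) := by
        refine intervalIntegral.integral_mono_on hb (hg.intervalIntegrable _ _)
          (((i1.add i2).const_mul _).const_mul _) fun θ hθ => (hgM θ).trans ?_
        gcongr
        exact norm_one_sub_circleMap_rpow_le (by linarith) hr hr1 hθ.1 hθ.2
    _ = M * (Real.pi ^ p * (2 * ∫ θ in (0 : ℝ)..2 * Real.pi, (1 - r + θ) ^ (-p))) := by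
        rw [intervalIntegral.integral_const_mul, intervalIntegral.integral_const_mul,
          intervalIntegral.integral_add i1 i2, e2, ← two_mul]
    _ ≤ _ := by
        rw [mul_div_assoc]
        gcongr

/-- Cauchy's estimate with the mean of `‖f‖` over the circle. The maximum would cost a factor of
order `n` for a function of size `|1 - ξ|^{-p}`. -/
theorem norm_iteratedDeriv_le_circle {f : ℂ → ℂ} {r : ℝ} (hr : 0 < r)
    (hf : DifferentiableOn ℂ f (closedBall 0 r)) (n : ℕ) :
    ‖iteratedDeriv n f 0‖ ≤ n.factorial *
      (((2 * Real.pi)⁻¹ * ∫ θ in (0 : ℝ)..2 * Real.pi, ‖f (circleMap 0 r θ)‖) * r⁻¹ ^ n) := by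
  lift r to NNReal using hr.le
  have h := DifferentiableOn.hasFPowerSeriesOnBall hf (by exact_mod_cast hr)
  have e := h.factorial_smul (1 : ℂ) n
  rw [← iteratedDeriv_eq_iteratedFDeriv] at e
  rw [← e, nsmul_eq_mul, norm_mul, Complex.norm_natCast]
  gcongr
  calc ‖cauchyPowerSeries f 0 r n fun _ => 1‖
      ≤ ‖cauchyPowerSeries f 0 r n‖ * ∏ _i : Fin n, ‖(1 : ℂ)‖ :=
        ContinuousMultilinearMap.le_opNorm _ _
    _ = ‖cauchyPowerSeries f 0 r n‖ := by simp
    _ ≤ _ := by simpa using norm_cauchyPowerSeries_le f 0 r n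

/-- A function on the unit disc that is `O(|1 - ξ|^{-p})`, `p > 1`, has Taylor coefficients of
order `n^{p-1}`. -/
theorem exists_norm_iteratedDeriv_le {p : ℝ} (hp : 1 < p) : ∃ C : ℝ, 0 < C ∧
    ∀ (f : ℂ → ℂ) (M : ℝ), 0 ≤ M → DifferentiableOn ℂ f (ball 0 1) →
      (∀ ξ ∈ ball (0 : ℂ) 1, ‖f ξ‖ ≤ M * ‖1 - ξ‖ ^ (-p)) →
      ∀ n : ℕ, ‖iteratedDeriv n f 0‖ ≤ n.factorial * (C * M * (n + 1 : ℝ) ^ (p - 1)) := by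
  have hpi := Real.pi_pos
  have hp0 : 0 < p - 1 := by linarith
  refine ⟨(2 * Real.pi)⁻¹ * (Real.pi ^ p * (2 * 2 ^ (p - 1) / (p - 1))) * Real.exp 1,
    by positivity, fun f M hM hf hfM n => ?_⟩
  have hn : (0 : ℝ) ≤ n := n.cast_nonneg
  -- With `1 - r = 1 / (n + 2)` the factor `r⁻¹ ^ n` stays below `e`, while the integral is of order
  -- `(1 - r)^{1-p}`, that is `n^{p-1}`.
  obtain ⟨r, hrdef⟩ : ∃ r : ℝ, r = (n + 1) / (n + 2) := ⟨_, rfl⟩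
  have hr : 1 / 2 ≤ r := by rw [hrdef, div_le_div_iff₀ (by norm_num) (by positivity)]; linarith
  have hr1 : r < 1 := by rw [hrdef, div_lt_one (by positivity)]; linarith
  have hr0 : 0 < r := by linarith
  have hsub : closedBall (0 : ℂ) r ⊆ ball 0 1 := closedBall_subset_ball hr1
  have hmem : ∀ θ, circleMap 0 r θ ∈ closedBall (0 : ℂ) r :=
    circleMap_mem_closedBall 0 hr0.le
  refine (norm_iteratedDeriv_le_circle hr0 (hf.mono hsub) n).trans ?_
  have hcont : Continuous fun θ => ‖f (circleMap 0 r θ)‖ :=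
    ((hf.mono hsub).continuousOn.comp_continuous (continuous_circleMap 0 r) hmem).norm
  have hint := integral_norm_one_sub_circleMap_rpow_le hp hr hr1 hcont hM
    fun θ => hfM _ (hsub (hmem θ))
  have hpow : r⁻¹ ^ n ≤ Real.exp 1 := by
    have h1 : r⁻¹ ≤ Real.exp (1 / (n + 1)) := by
      have := Real.add_one_le_exp (1 / (n + 1) : ℝ)
      refine le_trans (le_of_eq ?_) this
      rw [hrdef]; field_simp; ring
    calc r⁻¹ ^ n ≤ Real.exp (1 / (n + 1)) ^ n := by gcongr
      _ = Real.exp (n * (1 / (n + 1))) := by rw [← Real.exp_nat_mul]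
      _ ≤ Real.exp 1 := by
        gcongr
        rw [mul_one_div, div_le_one (by positivity)]; linarith
  have heps : (1 - r) ^ (1 - p) ≤ 2 ^ (p - 1) * (n + 1 : ℝ) ^ (p - 1) := by
    have : 1 - r = (n + 2 : ℝ)⁻¹ := by rw [hrdef]; field_simp; ring
    rw [this, Real.inv_rpow (by positivity), ← Real.rpow_neg (by positivity), neg_sub,
      ← Real.mul_rpow (by norm_num) (by positivity)]
    gcongr
    linarith
  calc (n.factorial : ℝ) *
      (((2 * Real.pi)⁻¹ * ∫ θ in (0 : ℝ)..2 * Real.pi, ‖f (circleMap 0 r θ)‖) * r⁻¹ ^ n)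
      ≤ n.factorial * (((2 * Real.pi)⁻¹ *
          (M * (Real.pi ^ p * (2 * (2 ^ (p - 1) * (n + 1 : ℝ) ^ (p - 1)) / (p - 1))))) *
            Real.exp 1) := by
        gcongr
        exact hint.trans (by gcongr)
    _ = _ := by ring

/-! ### The generating function `δ_k(ξ)^α` on the unit disc -/

theorem bdfGen_mem_slitPlane {k : ℕ} (hk1 : 1 ≤ k) (hk6 : k ≤ 6) {ξ : ℂ} (hξ : ‖ξ‖ ≤ 1)
    (hξ1 : ξ ≠ 1) : bdfGen k ξ ∈ Complex.slitPlane := by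
  by_contra h
  rw [Complex.mem_slitPlane_iff, not_or, not_lt, not_not] at h
  refine bdfGen_add_ne_zero hk1 hk6 hξ hξ1 (s := -(bdfGen k ξ).re) (by linarith [h.1]) ?_
  apply Complex.ext <;> simp [h.2]

theorem contDiff_bdfGen (k : ℕ) : ContDiff ℂ 2 (bdfGen k) := by
  unfold bdfGen
  fun_prop

/-- Factor `δ_k(ξ) = (1 - ξ) g(ξ)`. The cofactor equals `1` at `ξ = 1` and has no other zero on the
closed disc because `δ_k` has none, so compactness bounds it below. -/
theorem exists_mul_le_norm_bdfGen {k : ℕ} (hk1 : 1 ≤ k) (hk6 : k ≤ 6) :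
    ∃ c : ℝ, 0 < c ∧ ∀ ξ : ℂ, ‖ξ‖ ≤ 1 → c * ‖1 - ξ‖ ≤ ‖bdfGen k ξ‖ := by
  set g : ℂ → ℂ := fun ξ => ∑ l ∈ Finset.Icc 1 k, (1 / (l : ℂ)) * (1 - ξ) ^ (l - 1) with hg
  have hfac : ∀ ξ, bdfGen k ξ = (1 - ξ) * g ξ := fun ξ => by
    rw [hg, bdfGen, Finset.mul_sum]
    refine Finset.sum_congr rfl fun l hl => ?_
    obtain ⟨l, rfl⟩ := Nat.exists_eq_add_of_le' (Finset.mem_Icc.1 hl).1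
    rw [Nat.add_sub_cancel, pow_succ]
    ring
  have hg0 : ∀ ξ : ℂ, ‖ξ‖ ≤ 1 → g ξ ≠ 0 := fun ξ hξ h0 => by
    by_cases h1 : ξ = 1
    · subst h1
      simp only [hg] at h0
      rw [Finset.sum_eq_single_of_mem 1 (by simpa using hk1)] at h0
      · simp at h0
      · intro l hl hl1
        have : l - 1 ≠ 0 := by have := (Finset.mem_Icc.1 hl).1; omega
        simp [this]
    · have := bdfGen_add_ne_zero hk1 hk6 hξ h1 le_rfl
      simp [hfac, h0] at this
  have hcont : ContinuousOn (fun ξ => ‖g ξ‖) (closedBall (0 : ℂ) 1) := by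
    rw [hg]; fun_prop
  obtain ⟨x, hx, hmin⟩ := (isCompact_closedBall (0 : ℂ) 1).exists_isMinOn
    ⟨0, mem_closedBall_self zero_le_one⟩ hcont
  refine ⟨‖g x‖, norm_pos_iff.2 (hg0 x (by simpa using hx)), fun ξ hξ => ?_⟩
  rw [hfac, norm_mul, mul_comm]
  gcongr
  exact hmin (by simpa using hξ)

theorem exists_norm_le_of_continuous {f : ℂ → ℂ} (hf : Continuous f) :
    ∃ D : ℝ, 0 < D ∧ ∀ ξ : ℂ, ‖ξ‖ ≤ 1 → ‖f ξ‖ ≤ D := by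
  obtain ⟨D, hD⟩ := (isCompact_closedBall (0 : ℂ) 1).exists_bound_of_continuousOn hf.continuousOn
  exact ⟨max D 1, by positivity, fun ξ hξ => (hD ξ (by simpa using hξ)).trans (le_max_left _ _)⟩

theorem one_sub_ne_zero_of_mem_ball {ξ : ℂ} (hξ : ξ ∈ ball (0 : ℂ) 1) : 0 < ‖1 - ξ‖ := by
  rw [norm_pos_iff, sub_ne_zero]
  rintro rfl
  simp at hξ

theorem bdfGen_mem_slitPlane_of_mem_ball {k : ℕ} (hk1 : 1 ≤ k) (hk6 : k ≤ 6) {ξ : ℂ}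
    (hξ : ξ ∈ ball (0 : ℂ) 1) : bdfGen k ξ ∈ Complex.slitPlane :=
  bdfGen_mem_slitPlane hk1 hk6 (by simpa using (mem_ball_zero_iff.1 hξ).le)
    (by rintro rfl; simp at hξ)

theorem hasDerivAt_bdfGen_cpow {k : ℕ} (hk1 : 1 ≤ k) (hk6 : k ≤ 6) (c : ℂ) {ξ : ℂ}
    (hξ : ξ ∈ ball (0 : ℂ) 1) :
    HasDerivAt (fun ξ => bdfGen k ξ ^ c) (c * bdfGen k ξ ^ (c - 1) * deriv (bdfGen k) ξ) ξ :=
  (((contDiff_bdfGen k).differentiable (by norm_num)) ξ).hasDerivAt.cpow_const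
    (bdfGen_mem_slitPlane_of_mem_ball hk1 hk6 hξ)

theorem differentiableOn_bdfGen_cpow {k : ℕ} (hk1 : 1 ≤ k) (hk6 : k ≤ 6) (c : ℂ) :
    DifferentiableOn ℂ (fun ξ => bdfGen k ξ ^ c) (ball 0 1) := fun _ hξ =>
  (hasDerivAt_bdfGen_cpow hk1 hk6 c hξ).differentiableAt.differentiableWithinAt

theorem norm_bdfGen_cpow {k : ℕ} (α : ℝ) (ξ : ℂ) (h : bdfGen k ξ ≠ 0) :
    ‖bdfGen k ξ ^ (α : ℂ)‖ = ‖bdfGen k ξ‖ ^ α := by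
  rw [Complex.norm_cpow_of_ne_zero h]
  simp

theorem exists_norm_bdfGen_cpow_le {k : ℕ} (hk1 : 1 ≤ k) (hk6 : k ≤ 6) {a : ℝ} (ha : a ≤ 0) :
    ∃ C : ℝ, 0 < C ∧ ∀ ξ ∈ ball (0 : ℂ) 1, ‖bdfGen k ξ ^ (a : ℂ)‖ ≤ C * ‖1 - ξ‖ ^ a := by
  obtain ⟨c, hc, h⟩ := exists_mul_le_norm_bdfGen hk1 hk6
  refine ⟨c ^ a, by positivity, fun ξ hξ => ?_⟩
  have h1 := one_sub_ne_zero_of_mem_ball hξ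
  rw [norm_bdfGen_cpow _ _ (Complex.slitPlane_ne_zero
      (bdfGen_mem_slitPlane_of_mem_ball hk1 hk6 hξ)), ← Real.mul_rpow hc.le h1.le]
  exact Real.rpow_le_rpow_of_nonpos (by positivity) (h ξ (mem_ball_zero_iff.1 hξ).le) ha

theorem exists_norm_deriv_bdfGen_cpow_le {k : ℕ} (hk1 : 1 ≤ k) (hk6 : k ≤ 6) {a : ℝ}
    (ha : a ≤ 1) : ∃ C : ℝ, 0 < C ∧ ∀ ξ ∈ ball (0 : ℂ) 1,
      ‖deriv (fun ξ => bdfGen k ξ ^ (a : ℂ)) ξ‖ ≤ C * ‖1 - ξ‖ ^ (a - 1) := by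
  obtain ⟨C, hC, h⟩ := exists_norm_bdfGen_cpow_le hk1 hk6 (a := a - 1) (by linarith)
  obtain ⟨D, hD, hD'⟩ := exists_norm_le_of_continuous
    ((contDiff_bdfGen k).continuous_deriv (by norm_num))
  refine ⟨(|a| + 1) * C * D, by positivity, fun ξ hξ => ?_⟩
  have h1 := one_sub_ne_zero_of_mem_ball hξ
  rw [(hasDerivAt_bdfGen_cpow hk1 hk6 _ hξ).deriv, norm_mul, norm_mul, Complex.norm_real,
    Real.norm_eq_abs]
  have h2 := h ξ hξ
  push_cast at h2
  calc |a| * ‖bdfGen k ξ ^ ((a : ℂ) - 1)‖ * ‖deriv (bdfGen k) ξ‖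
      ≤ (|a| + 1) * (C * ‖1 - ξ‖ ^ (a - 1)) * D := by
        gcongr
        · linarith
        · exact hD' ξ (mem_ball_zero_iff.1 hξ).le
    _ = _ := by ring

theorem exists_norm_deriv_deriv_bdfGen_cpow_le {k : ℕ} (hk1 : 1 ≤ k) (hk6 : k ≤ 6) {a : ℝ}
    (ha : a ≤ 1) : ∃ C : ℝ, 0 < C ∧ ∀ ξ ∈ ball (0 : ℂ) 1,
      ‖deriv (deriv (fun ξ => bdfGen k ξ ^ (a : ℂ))) ξ‖ ≤ C * ‖1 - ξ‖ ^ (a - 2) := by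
  obtain ⟨C, hC, h⟩ := exists_norm_bdfGen_cpow_le hk1 hk6 (a := a - 1) (by linarith)
  obtain ⟨C', hC', h'⟩ := exists_norm_deriv_bdfGen_cpow_le hk1 hk6 (a := a - 1) (by linarith)
  obtain ⟨D, hD, hD'⟩ := exists_norm_le_of_continuous
    ((contDiff_bdfGen k).continuous_deriv (by norm_num))
  have hd1 : ContDiff ℂ 1 (deriv (bdfGen k)) := (contDiff_bdfGen k).deriv'
  obtain ⟨E, hE, hE'⟩ := exists_norm_le_of_continuous (hd1.continuous_deriv le_rfl)
  refine ⟨(|a| + 1) * (C' * D + C * 2 * E), by positivity, fun ξ hξ => ?_⟩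
  have h1 := one_sub_ne_zero_of_mem_ball hξ
  have hξ1 := (mem_ball_zero_iff.1 hξ).le
  have heq : deriv (fun ξ => bdfGen k ξ ^ (a : ℂ)) =ᶠ[nhds ξ]
      fun ξ => a * (bdfGen k ξ ^ ((a - 1 : ℝ) : ℂ) * deriv (bdfGen k) ξ) := by
    filter_upwards [isOpen_ball.mem_nhds hξ] with x hx
    rw [(hasDerivAt_bdfGen_cpow hk1 hk6 _ hx).deriv]
    push_cast
    ring
  have hdiff := (differentiableOn_bdfGen_cpow hk1 hk6 ((a - 1 : ℝ) : ℂ)).differentiableAt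
    (isOpen_ball.mem_nhds hξ)
  have hd : HasDerivAt (fun ξ => a * (bdfGen k ξ ^ ((a - 1 : ℝ) : ℂ) * deriv (bdfGen k) ξ))
      (a * (deriv (fun ξ => bdfGen k ξ ^ ((a - 1 : ℝ) : ℂ)) ξ * deriv (bdfGen k) ξ +
        bdfGen k ξ ^ ((a - 1 : ℝ) : ℂ) * deriv (deriv (bdfGen k)) ξ)) ξ :=
    (hdiff.hasDerivAt.mul (hd1.differentiable (by norm_num) ξ).hasDerivAt).const_mul _
  rw [heq.deriv_eq, hd.deriv, norm_mul, Complex.norm_real, Real.norm_eq_abs]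
  -- The term with `δ_k''` is less singular by one power; it is absorbed using `|1 - ξ| ≤ 2`.
  have hle : ‖1 - ξ‖ ^ (a - 1) ≤ 2 * ‖1 - ξ‖ ^ (a - 2) := by
    rw [show a - 1 = (a - 2) + 1 by ring, Real.rpow_add_one h1.ne', mul_comm]
    gcongr
    calc ‖1 - ξ‖ ≤ ‖(1 : ℂ)‖ + ‖ξ‖ := norm_sub_le _ _
      _ ≤ 2 := by rw [norm_one]; linarith
  have h'' := h' ξ hξ
  rw [show a - 1 - 1 = a - 2 by ring] at h''
  calc |a| * ‖deriv (fun ξ => bdfGen k ξ ^ ((a - 1 : ℝ) : ℂ)) ξ * deriv (bdfGen k) ξ +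
        bdfGen k ξ ^ ((a - 1 : ℝ) : ℂ) * deriv (deriv (bdfGen k)) ξ‖
      ≤ (|a| + 1) * (C' * ‖1 - ξ‖ ^ (a - 2) * D + C * (2 * ‖1 - ξ‖ ^ (a - 2)) * E) := by
        gcongr
        · linarith
        · refine (norm_add_le _ _).trans ?_
          rw [norm_mul, norm_mul]
          gcongr
          · exact hD' ξ hξ1
          · exact (h ξ hξ).trans (by gcongr)
          · exact hE' ξ hξ1
    _ = _ := by ring

/-- The convolution quadrature weights decay like `j^{-1-α}`. -/
theorem exists_norm_cqWeight_le {k : ℕ} (hk1 : 1 ≤ k) (hk6 : k ≤ 6) {α : ℝ} (hα0 : 0 < α)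
    (hα1 : α < 1) : ∃ C : ℝ, 0 < C ∧ ∀ j : ℕ, 1 ≤ j →
      ‖cqWeight k α j‖ ≤ C * (j : ℝ) ^ (-1 - α) := by
  obtain ⟨M, hM, hM'⟩ := exists_norm_deriv_deriv_bdfGen_cpow_le hk1 hk6 hα1.le
  -- The coefficient bound needs an exponent `p > 1`, hence two derivatives of `δ_k^α`: their
  -- singularity has `p = 2 - α`, and their `n`-th coefficient is `(n+2)(n+1) ω_{n+2}`. The weight
  -- `ω_1` is not reached this way and enters the constant directly.
  obtain ⟨C, hC, hC'⟩ := exists_norm_iteratedDeriv_le (p := 2 - α) (by linarith)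
  refine ⟨‖cqWeight k α 1‖ + C * M * 2, by positivity, fun j hj => ?_⟩
  rcases hj.eq_or_lt with rfl | hj
  · simp only [Nat.cast_one, Real.one_rpow, mul_one]
    linarith [mul_pos hC hM]
  obtain ⟨n, rfl⟩ : ∃ n, j = n + 2 := ⟨j - 2, by omega⟩
  have hn : (0 : ℝ) ≤ n := n.cast_nonneg
  have h := hC' (deriv (deriv (fun ξ => bdfGen k ξ ^ (α : ℂ)))) M hM.le
    (((differentiableOn_bdfGen_cpow hk1 hk6 α).deriv isOpen_ball).deriv isOpen_ball)
    (fun ξ hξ => by rw [neg_sub]; exact hM' ξ hξ) n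
  rw [← iteratedDeriv_succ', ← iteratedDeriv_succ'] at h
  have hfac : ((n + 2).factorial : ℝ) = (n + 2) * (n + 1) * n.factorial := by
    rw [Nat.factorial_succ, Nat.factorial_succ]; push_cast; ring
  have hn0 : (0 : ℝ) < n.factorial := by exact_mod_cast n.factorial_pos
  have hpow : (n + 1 : ℝ) ^ (-α) ≤ 2 * (n + 2 : ℝ) ^ (-α) := by
    calc (n + 1 : ℝ) ^ (-α) ≤ ((n + 2 : ℝ) / 2) ^ (-α) :=
          Real.rpow_le_rpow_of_nonpos (by positivity) (by linarith) (by linarith)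
      _ = 2 ^ α * (n + 2 : ℝ) ^ (-α) := by
          rw [Real.div_rpow (by positivity) (by norm_num), Real.rpow_neg (by norm_num : (0:ℝ) ≤ 2),
            div_inv_eq_mul, mul_comm]
      _ ≤ 2 * (n + 2 : ℝ) ^ (-α) := by
          gcongr
          simpa using Real.rpow_le_rpow_of_exponent_le (x := 2) (by norm_num) hα1.le
  rw [cqWeight, norm_div, Complex.norm_natCast, hfac, div_le_iff₀ (by positivity)]
  push_cast
  calc ‖iteratedDeriv (n + 2) (fun ξ => bdfGen k ξ ^ (α : ℂ)) 0‖
      ≤ n.factorial * (C * M * (n + 1 : ℝ) ^ (2 - α - 1)) := h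
    _ = n.factorial * (C * M * (n + 1) * (n + 1 : ℝ) ^ (-α)) := by
        rw [show 2 - α - 1 = -α + 1 by ring, Real.rpow_add_one (by positivity)]; ring
    _ ≤ n.factorial * (C * M * (n + 1) * (2 * (n + 2 : ℝ) ^ (-α))) := by gcongr
    _ = C * M * 2 * (n + 2 : ℝ) ^ (-1 - α) * ((n + 2) * (n + 1) * n.factorial) := by
        rw [show -α = (-1 - α) + 1 by ring, Real.rpow_add_one (by positivity)]; ring
    _ ≤ _ := by
        gcongr
        exact le_add_of_nonneg_left (norm_nonneg _)

/-! ### The discrete solution operator of the scalar problem -/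

/-- Rotate by minus half the argument of `z^α`. Then `1` and `b z^α` lie symmetrically at angles
`∓φ` with `|φ| ≤ απ/2 < π/2`, and no cancellation occurs in the real part. -/
theorem cos_mul_le_norm_one_add_mul_cpow {α : ℝ} (hα0 : 0 < α) (hα1 : α < 1) {b : ℝ}
    (hb : 0 ≤ b) {z : ℂ} (hz : z ≠ 0) :
    Real.cos (α * Real.pi / 2) * (1 + b * ‖z ^ (α : ℂ)‖) ≤ ‖1 + b * z ^ (α : ℂ)‖ := by
  obtain ⟨φ, hφ⟩ : ∃ φ : ℝ, φ = α * z.arg / 2 := ⟨_, rfl⟩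
  have hpi := Real.pi_pos
  have harg := Complex.abs_arg_le_pi z
  have hpol : z ^ (α : ℂ) = (‖z ^ (α : ℂ)‖ : ℂ) * Complex.exp (φ * Complex.I) ^ 2 := by
    rw [← Complex.exp_nat_mul, Complex.norm_cpow_of_ne_zero hz, Complex.cpow_def_of_ne_zero hz,
      hφ, Complex.log]
    simp only [Complex.ofReal_im, mul_zero, Real.exp_zero, div_one, Complex.ofReal_re]
    rw [Real.rpow_def_of_pos (norm_pos_iff.2 hz), Complex.ofReal_exp, ← Complex.exp_add]
    congr 1
    push_cast
    ring
  have hcos : Real.cos (α * Real.pi / 2) ≤ Real.cos φ := by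
    rw [← Real.cos_abs φ]
    apply Real.cos_le_cos_of_nonneg_of_le_pi (abs_nonneg _)
    · nlinarith
    · rw [hφ, abs_div, abs_mul, abs_of_pos hα0, abs_two]
      gcongr
  have hrot : Complex.exp (-φ * Complex.I) * (1 + b * z ^ (α : ℂ)) =
      Complex.exp ((-φ : ℝ) * Complex.I) +
        ((b * ‖z ^ (α : ℂ)‖ : ℝ) : ℂ) * Complex.exp (φ * Complex.I) := by
    conv_lhs => rw [hpol]
    have : Complex.exp (-φ * Complex.I) * Complex.exp (φ * Complex.I) = 1 := by
      rw [← Complex.exp_add]; simp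
    push_cast
    linear_combination (b * ‖z ^ (α : ℂ)‖ * Complex.exp (φ * Complex.I)) * this
  calc Real.cos (α * Real.pi / 2) * (1 + b * ‖z ^ (α : ℂ)‖)
      ≤ Real.cos φ * (1 + b * ‖z ^ (α : ℂ)‖) := by gcongr
    _ = (Complex.exp (-φ * Complex.I) * (1 + b * z ^ (α : ℂ))).re := by
        rw [hrot, Complex.add_re, Complex.exp_ofReal_mul_I_re, Complex.re_ofReal_mul,
          Complex.exp_ofReal_mul_I_re, Real.cos_neg]
        ring
    _ ≤ ‖Complex.exp (-φ * Complex.I) * (1 + b * z ^ (α : ℂ))‖ := Complex.re_le_norm _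
    _ = ‖1 + b * z ^ (α : ℂ)‖ := by
        rw [norm_mul, ← Complex.ofReal_neg, Complex.norm_exp_ofReal_mul_I, one_mul]

/-- The Taylor coefficients at `0` of `ξ ↦ (1 + b δ_k(ξ)^α)⁻¹`. -/
noncomputable def resolventCoeff (k : ℕ) (α : ℝ) (n : ℕ) (b : ℂ) : ℂ :=
  iteratedDeriv n (fun ξ : ℂ => (1 + b * bdfGen k ξ ^ (α : ℂ))⁻¹) 0 / (n.factorial : ℂ)

theorem one_add_mul_bdfGen_cpow_ne_zero {k : ℕ} (hk1 : 1 ≤ k) (hk6 : k ≤ 6) {α : ℝ}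
    (hα0 : 0 < α) (hα1 : α < 1) {b : ℝ} (hb : 0 ≤ b) {ξ : ℂ} (hξ : ξ ∈ ball (0 : ℂ) 1) :
    1 + (b : ℂ) * bdfGen k ξ ^ (α : ℂ) ≠ 0 := by
  have hpi := Real.pi_pos
  have hc : 0 < Real.cos (α * Real.pi / 2) :=
    Real.cos_pos_of_mem_Ioo ⟨by nlinarith, by nlinarith⟩
  rw [← norm_pos_iff]
  exact lt_of_lt_of_le (by positivity) (cos_mul_le_norm_one_add_mul_cpow hα0 hα1 hb
    (Complex.slitPlane_ne_zero (bdfGen_mem_slitPlane_of_mem_ball hk1 hk6 hξ)))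

theorem differentiableOn_resolvent {k : ℕ} (hk1 : 1 ≤ k) (hk6 : k ≤ 6) {α : ℝ}
    (hα0 : 0 < α) (hα1 : α < 1) {b : ℝ} (hb : 0 ≤ b) :
    DifferentiableOn ℂ (fun ξ => (1 + (b : ℂ) * bdfGen k ξ ^ (α : ℂ))⁻¹) (ball 0 1) :=
  (((differentiableOn_bdfGen_cpow hk1 hk6 α).const_mul _).const_add _).inv
    fun _ hξ => one_add_mul_bdfGen_cpow_ne_zero hk1 hk6 hα0 hα1 hb hξ

theorem cqWeight_zero (k : ℕ) (α : ℝ) : cqWeight k α 0 = bdfGen k 0 ^ (α : ℂ) := by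
  simp [cqWeight]

theorem resolventCoeff_zero (k : ℕ) (α : ℝ) (b : ℂ) :
    resolventCoeff k α 0 b = (1 + b * cqWeight k α 0)⁻¹ := by
  simp [resolventCoeff, cqWeight_zero]

theorem norm_mul_inv_one_add_mul_le {c b x : ℝ} {z : ℂ} (hc : 0 < c) (hb : 0 ≤ b) (hx : 0 < x)
    (h : c * (1 + b * x) ≤ ‖1 + b * z‖) : ‖(b : ℂ) * (1 + b * z)⁻¹‖ ≤ (c * x)⁻¹ := by
  have h1 : 0 < ‖1 + b * z‖ := lt_of_lt_of_le (by positivity) h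
  rw [norm_mul, norm_inv, Complex.norm_real, Real.norm_of_nonneg hb, ← div_eq_mul_inv,
    div_le_iff₀ h1, inv_mul_eq_div, le_div_iff₀ (by positivity)]
  nlinarith

/-- Uniformly in `b ≥ 0`, the Taylor coefficients of `b (1 + b δ_k^α)⁻¹` are of order
`n^{α-1}`. -/
theorem exists_norm_mul_resolventCoeff_le {k : ℕ} (hk1 : 1 ≤ k) (hk6 : k ≤ 6) {α : ℝ}
    (hα0 : 0 < α) (hα1 : α < 1) : ∃ C : ℝ, 0 < C ∧ ∀ (b : ℝ), 0 ≤ b → ∀ n : ℕ,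
      ‖(b : ℂ) * resolventCoeff k α n b‖ ≤ C * (n + 1 : ℝ) ^ (α - 1) := by
  have hpi := Real.pi_pos
  obtain ⟨c, hcdef⟩ : ∃ c, c = Real.cos (α * Real.pi / 2) := ⟨_, rfl⟩
  have hc : 0 < c := hcdef ▸ Real.cos_pos_of_mem_Ioo ⟨by nlinarith, by nlinarith⟩
  obtain ⟨m, hm, hm'⟩ := exists_mul_le_norm_bdfGen hk1 hk6
  obtain ⟨D, hD, hD'⟩ := exists_norm_deriv_bdfGen_cpow_le hk1 hk6 hα1.le
  -- The function `b (1 + b δ_k^α)⁻¹` is only `O(|1 - ξ|^{-α})` with `α < 1`, so it is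
  -- differentiated once. The derivative is `-(δ_k^α)' (b (1 + b δ_k^α)⁻¹)²`, of size `|1 -
  -- ξ|^{α-1-2α}`, hence `p = 1 + α`. The coefficient with `n = 0` is read off at `ξ = 0`.
  obtain ⟨C, hC, hC'⟩ := exists_norm_iteratedDeriv_le (p := 1 + α) (by linarith)
  have hsec : ∀ (b : ℝ), 0 ≤ b → ∀ ξ ∈ ball (0 : ℂ) 1,
      ‖(b : ℂ) * (1 + b * bdfGen k ξ ^ (α : ℂ))⁻¹‖ ≤ (c * (m ^ α * ‖1 - ξ‖ ^ α))⁻¹ := by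
    intro b hb ξ hξ
    have h1 := one_sub_ne_zero_of_mem_ball hξ
    have hne := Complex.slitPlane_ne_zero (bdfGen_mem_slitPlane_of_mem_ball hk1 hk6 hξ)
    refine norm_mul_inv_one_add_mul_le hc hb (by positivity)
      (le_trans ?_ (cos_mul_le_norm_one_add_mul_cpow hα0 hα1 hb hne))
    rw [← hcdef, norm_bdfGen_cpow _ _ hne, ← Real.mul_rpow hm.le h1.le]
    gcongr
    exact hm' ξ (mem_ball_zero_iff.1 hξ).le
  obtain ⟨K, hK⟩ : ∃ K, K = (c * m ^ α)⁻¹ := ⟨_, rfl⟩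
  have hK0 : 0 < K := by rw [hK]; positivity
  refine ⟨K + C * (K ^ 2 * D) * 2, by positivity, fun b hb n => ?_⟩
  rcases n with _ | n
  · have h := hsec b hb 0 (mem_ball_self one_pos)
    simp only [sub_zero, norm_one, Real.one_rpow, mul_one] at h
    simp only [resolventCoeff_zero, cqWeight_zero, Nat.cast_zero, zero_add, Real.one_rpow, mul_one]
    refine h.trans ?_
    rw [← hK]
    exact le_add_of_nonneg_right (by positivity)
  have hn : (0 : ℝ) ≤ n := n.cast_nonneg
  have h := hC' (fun ξ => b * deriv (fun ξ => (1 + (b : ℂ) * bdfGen k ξ ^ (α : ℂ))⁻¹) ξ)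
    (K ^ 2 * D) (by positivity)
    (((differentiableOn_resolvent hk1 hk6 hα0 hα1 hb).deriv isOpen_ball).const_mul _) (fun ξ hξ => by
      have h1 := one_sub_ne_zero_of_mem_ball hξ
      have hd := (((differentiableOn_bdfGen_cpow hk1 hk6 α).differentiableAt
        (isOpen_ball.mem_nhds hξ)).hasDerivAt.const_mul (b : ℂ)).const_add 1
      have hd' := hd.fun_inv (one_add_mul_bdfGen_cpow_ne_zero hk1 hk6 hα0 hα1 hb hξ)
      rw [hd'.deriv]
      have e : ∀ x y : ℂ, (b : ℂ) * (-(b * x) / y ^ 2) = -(x * (b * y⁻¹) ^ 2) := fun x y => by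
        rw [div_eq_mul_inv, ← inv_pow]; ring
      rw [e, norm_neg, norm_mul, norm_pow]
      calc ‖deriv (fun ξ => bdfGen k ξ ^ (α : ℂ)) ξ‖ *
            ‖(b : ℂ) * (1 + b * bdfGen k ξ ^ (α : ℂ))⁻¹‖ ^ 2
          ≤ (D * ‖1 - ξ‖ ^ (α - 1)) * ((c * (m ^ α * ‖1 - ξ‖ ^ α))⁻¹) ^ 2 := by
            gcongr
            · exact hD' ξ hξ
            · exact hsec b hb ξ hξ
        _ = K ^ 2 * D * ‖1 - ξ‖ ^ (-(1 + α)) := by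
            rw [show -(1 + α) = (α - 1) + -α + -α by ring, Real.rpow_add h1, Real.rpow_add h1,
              Real.rpow_neg h1.le, hK, ← mul_assoc c, mul_inv]
            ring) n
  rw [iteratedDeriv_const_mul_field, ← iteratedDeriv_succ'] at h
  have hn0 : (0 : ℝ) < n.factorial := by exact_mod_cast n.factorial_pos
  have hpow : (n + 1 : ℝ) ^ (α - 1) ≤ 2 * (n + 2 : ℝ) ^ (α - 1) := by
    calc (n + 1 : ℝ) ^ (α - 1) ≤ ((n + 2 : ℝ) / 2) ^ (α - 1) :=
          Real.rpow_le_rpow_of_nonpos (by positivity) (by linarith) (by linarith)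
      _ = 2 ^ (1 - α) * (n + 2 : ℝ) ^ (α - 1) := by
          rw [Real.div_rpow (by positivity) (by norm_num), ← neg_sub α 1,
            Real.rpow_neg (by norm_num : (0:ℝ) ≤ 2), div_eq_mul_inv, mul_comm]
      _ ≤ 2 * (n + 2 : ℝ) ^ (α - 1) := by
          gcongr
          simpa using Real.rpow_le_rpow_of_exponent_le (x := 2) (y := 1 - α) (z := 1)
            (by norm_num) (by linarith)
  rw [resolventCoeff, mul_div_assoc', norm_div, Complex.norm_natCast,
    div_le_iff₀ (by exact_mod_cast (n + 1).factorial_pos), Nat.factorial_succ]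
  push_cast
  rw [add_assoc (n : ℝ) 1 1, one_add_one_eq_two]
  calc _ ≤ n.factorial * (C * (K ^ 2 * D) * (n + 1 : ℝ) ^ (1 + α - 1)) := h
    _ = C * (K ^ 2 * D) * (n + 1 : ℝ) ^ (α - 1) * ((n + 1) * n.factorial) := by
        rw [show 1 + α - 1 = (α - 1) + 1 by ring, Real.rpow_add_one (by positivity)]; ring
    _ ≤ C * (K ^ 2 * D) * (2 * (n + 2 : ℝ) ^ (α - 1)) * ((n + 1) * n.factorial) := by gcongr
    _ = C * (K ^ 2 * D) * 2 * (n + 2 : ℝ) ^ (α - 1) * ((n + 1) * n.factorial) := by ring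
    _ ≤ _ := by
        gcongr
        exact le_add_of_nonneg_left hK0.le

/-- The coefficient of `ξ^n` in `f + b δ_k^α f = 1`, where `f = (1 + b δ_k^α)⁻¹`. -/
theorem resolventCoeff_add_sum {k : ℕ} (hk1 : 1 ≤ k) (hk6 : k ≤ 6) {α : ℝ}
    (hα0 : 0 < α) (hα1 : α < 1) {b : ℝ} (hb : 0 ≤ b) (n : ℕ) :
    resolventCoeff k α n b +
      b * ∑ i ∈ Finset.range (n + 1), cqWeight k α i * resolventCoeff k α (n - i) b =
        if n = 0 then 1 else 0 := by
  set h : ℂ → ℂ := fun ξ => bdfGen k ξ ^ (α : ℂ) with hh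
  set f : ℂ → ℂ := fun ξ => (1 + (b : ℂ) * bdfGen k ξ ^ (α : ℂ))⁻¹ with hf
  have h0 : ball (0 : ℂ) 1 ∈ nhds 0 := ball_mem_nhds 0 one_pos
  have hca : ContDiffAt ℂ n h 0 :=
    ((differentiableOn_bdfGen_cpow hk1 hk6 α).analyticAt h0).contDiffAt
  have fca : ContDiffAt ℂ n f 0 :=
    ((differentiableOn_resolvent hk1 hk6 hα0 hα1 hb).analyticAt h0).contDiffAt
  have heq : (f + fun ξ => (b : ℂ) * (h * f) ξ) =ᶠ[nhds 0] fun _ => 1 := by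
    filter_upwards [h0] with ξ hξ
    have := one_add_mul_bdfGen_cpow_ne_zero hk1 hk6 hα0 hα1 hb hξ
    simp only [Pi.add_apply, Pi.mul_apply, hf, hh]
    field_simp
  have key := heq.iteratedDeriv_eq n
  have hbca : ContDiffAt ℂ n (fun ξ => (b : ℂ) * (h * f) ξ) 0 := contDiffAt_const.mul (hca.mul fca)
  rw [iteratedDeriv_add fca hbca,
    iteratedDeriv_const_mul_field, iteratedDeriv_mul hca fca, iteratedDeriv_const] at key
  have hn0 : (n.factorial : ℂ) ≠ 0 := by exact_mod_cast n.factorial_ne_zero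
  have hsum : ∑ i ∈ Finset.range (n + 1), cqWeight k α i * resolventCoeff k α (n - i) b =
      (∑ i ∈ Finset.range (n + 1), (n.choose i : ℂ) * iteratedDeriv i h 0 *
        iteratedDeriv (n - i) f 0) / n.factorial := by
    rw [Finset.sum_div]
    refine Finset.sum_congr rfl fun i hi => ?_
    rw [Nat.cast_choose ℂ (Nat.lt_succ_iff.1 (Finset.mem_range.1 hi)), cqWeight, resolventCoeff]
    have h1 : (i.factorial : ℂ) ≠ 0 := by exact_mod_cast i.factorial_ne_zero
    have h2 : ((n - i).factorial : ℂ) ≠ 0 := by exact_mod_cast (n - i).factorial_ne_zero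
    change iteratedDeriv i h 0 / _ * (iteratedDeriv (n - i) f 0 / _) = _
    field_simp
  rw [hsum, resolventCoeff, mul_div_assoc', ← add_div, key]
  split_ifs with hn
  · simp [hn]
  · simp

/-- Continuity on the spectrum is essential, since `cfc` takes a default value otherwise. The
coefficient identity determines the `n`-th coefficient from the earlier ones after division by `1 +
b ω_0 ≠ 0`. -/
theorem continuousOn_resolventCoeff {k : ℕ} (hk1 : 1 ≤ k) (hk6 : k ≤ 6) {α : ℝ}
    (hα0 : 0 < α) (hα1 : α < 1) (n : ℕ) :
    ContinuousOn (resolventCoeff k α n) {z : ℂ | ∃ b : ℝ, 0 ≤ b ∧ z = b} := by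
  induction n using Nat.strong_induction_on with
  | _ n ih =>
    have hne : ∀ z ∈ {z : ℂ | ∃ b : ℝ, 0 ≤ b ∧ z = b}, 1 + z * cqWeight k α 0 ≠ 0 := by
      rintro z ⟨b, hb, rfl⟩
      rw [cqWeight_zero]
      exact one_add_mul_bdfGen_cpow_ne_zero hk1 hk6 hα0 hα1 hb (mem_ball_self one_pos)
    have hcont : ContinuousOn (fun z : ℂ => ((if n = 0 then 1 else 0) -
        z * ∑ i ∈ Finset.range n, cqWeight k α (i + 1) * resolventCoeff k α (n - (i + 1)) z) *
          (1 + z * cqWeight k α 0)⁻¹) {z : ℂ | ∃ b : ℝ, 0 ≤ b ∧ z = b} := by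
      refine ContinuousOn.mul (continuousOn_const.sub (continuousOn_id.mul
        (continuousOn_finsetSum _ fun i hi => continuousOn_const.mul
          (ih _ (by have := Finset.mem_range.1 hi; omega))))) (ContinuousOn.inv₀ ?_ hne)
      fun_prop
    refine hcont.congr fun z hz => ?_
    have h0 := hne z hz
    obtain ⟨b, hb, rfl⟩ := hz
    have := resolventCoeff_add_sum hk1 hk6 hα0 hα1 hb n
    rw [Finset.sum_range_succ', Nat.sub_zero] at this
    rw [eq_mul_inv_iff_mul_eq₀ h0, ← this]
    ring

/-! ### The discrete solution operator on a Hilbert space -/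

section Operator

variable {H : Type*} [NormedAddCommGroup H] [InnerProductSpace ℂ H] [CompleteSpace H]

open scoped ComplexOrder in
theorem spectrum_subset_of_isPositive {B : H →L[ℂ] H} (hB : B.IsPositive) :
    spectrum ℂ B ⊆ {z : ℂ | ∃ b : ℝ, 0 ≤ b ∧ z = b} := fun z hz => by
  have h0 : 0 ≤ z := spectrum_nonneg_of_nonneg (B.nonneg_iff_isPositive.2 hB) hz
  rw [Complex.nonneg_iff] at h0
  exact ⟨z.re, h0.1, Complex.ext rfl (by simp [← h0.2])⟩

/-- The Taylor coefficients at `0` of `ξ ↦ (1 + δ_k(ξ)^α B)⁻¹`. -/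
noncomputable def resolventOp (k : ℕ) (α : ℝ) (B : H →L[ℂ] H) (n : ℕ) : H →L[ℂ] H :=
  cfc (resolventCoeff k α n) B

theorem resolventOp_mul {k : ℕ} (hk1 : 1 ≤ k) (hk6 : k ≤ 6) {α : ℝ} (hα0 : 0 < α) (hα1 : α < 1)
    {B : H →L[ℂ] H} (hB : B.IsPositive) (n : ℕ) :
    resolventOp k α B n * B = cfc (fun z => resolventCoeff k α n z * z) B := by
  have hN : IsStarNormal B := hB.isSelfAdjoint.isStarNormal
  have hc : ContinuousOn (resolventCoeff k α n) (spectrum ℂ B) :=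
    (continuousOn_resolventCoeff hk1 hk6 hα0 hα1 n).mono (spectrum_subset_of_isPositive hB)
  rw [cfc_mul (resolventCoeff k α n) (fun z => z) B hc continuousOn_id, cfc_id' ℂ B, resolventOp]

theorem resolventOp_add_sum {k : ℕ} (hk1 : 1 ≤ k) (hk6 : k ≤ 6) {α : ℝ} (hα0 : 0 < α)
    (hα1 : α < 1) {B : H →L[ℂ] H} (hB : B.IsPositive) (n : ℕ) :
    resolventOp k α B n +
      ∑ i ∈ Finset.range (n + 1), cqWeight k α i • (resolventOp k α B (n - i) * B) =
        if n = 0 then 1 else 0 := by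
  have hN : IsStarNormal B := hB.isSelfAdjoint.isStarNormal
  have hc : ∀ n, ContinuousOn (resolventCoeff k α n) (spectrum ℂ B) := fun n =>
    (continuousOn_resolventCoeff hk1 hk6 hα0 hα1 n).mono (spectrum_subset_of_isPositive hB)
  have hc' : ∀ i, ContinuousOn (fun z => cqWeight k α i * (resolventCoeff k α (n - i) z * z))
      (spectrum ℂ B) := fun i => continuousOn_const.mul ((hc _).mul continuousOn_id)
  have e : ∀ i ∈ Finset.range (n + 1), cqWeight k α i • (resolventOp k α B (n - i) * B) =
      cfc (fun z => cqWeight k α i * (resolventCoeff k α (n - i) z * z)) B := fun i _ => by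
    rw [resolventOp_mul hk1 hk6 hα0 hα1 hB]
    exact (cfc_const_mul _ _ B ((hc _).mul continuousOn_id)).symm
  rw [Finset.sum_congr rfl e, ← cfc_sum _ B _ fun i _ => hc' i, resolventOp,
    ← cfc_add B _ _ (hc n) (by
      rw [Finset.sum_fn]
      exact continuousOn_finsetSum _ fun i _ => hc' i)]
  have e2 : Set.EqOn (fun z => resolventCoeff k α n z + (∑ i ∈ Finset.range (n + 1),
      fun z => cqWeight k α i * (resolventCoeff k α (n - i) z * z)) z)
      (fun _ => if n = 0 then 1 else 0) (spectrum ℂ B) := fun z hz => by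
    obtain ⟨b, hb, rfl⟩ := spectrum_subset_of_isPositive hB hz
    simp only [Finset.sum_apply]
    rw [← resolventCoeff_add_sum hk1 hk6 hα0 hα1 hb n, Finset.mul_sum]
    congr 1
    exact Finset.sum_congr rfl fun i _ => by ring
  rw [cfc_congr e2]
  split_ifs
  · exact cfc_const_one ℂ B
  · exact cfc_const_zero ℂ B

theorem exists_norm_resolventOp_mul_le {k : ℕ} (hk1 : 1 ≤ k) (hk6 : k ≤ 6) {α : ℝ} (hα0 : 0 < α)
    (hα1 : α < 1) : ∃ C : ℝ, 0 < C ∧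
      ∀ (H : Type*) [NormedAddCommGroup H] [InnerProductSpace ℂ H] [CompleteSpace H]
        (B : H →L[ℂ] H), B.IsPositive → ∀ n : ℕ,
        ‖resolventOp k α B n * B‖ ≤ C * (n + 1 : ℝ) ^ (α - 1) := by
  obtain ⟨C, hC, h⟩ := exists_norm_mul_resolventCoeff_le hk1 hk6 hα0 hα1
  refine ⟨C, hC, fun H _ _ _ B hB n => ?_⟩
  rw [resolventOp_mul hk1 hk6 hα0 hα1 hB]
  refine norm_cfc_le (by positivity) fun z hz => ?_
  obtain ⟨b, hb, rfl⟩ := spectrum_subset_of_isPositive hB hz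
  rw [mul_comm]
  exact h b hb n

/-- Variation of constants: the solution of a discrete Volterra equation is the convolution of
the source with the discrete solution operator. -/
theorem eq_sum_resolventOp {k : ℕ} (hk1 : 1 ≤ k) (hk6 : k ≤ 6) {α : ℝ} (hα0 : 0 < α)
    (hα1 : α < 1) {B : H →L[ℂ] H} (hB : B.IsPositive) {u g : ℕ → H} {n : ℕ}
    (h : ∀ l ≤ n, u l + B (∑ j ∈ Finset.range (l + 1), cqWeight k α j • u (l - j)) = -B (g l)) :
    u n = -∑ l ∈ Finset.range (n + 1), (resolventOp k α B (n - l) * B) (g l) := by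
  have h1 : ∀ l ∈ Finset.range (n + 1), (resolventOp k α B (n - l) * B) (g l) =
      -(resolventOp k α B (n - l) (u l) + ∑ q ∈ Finset.range (l + 1),
        cqWeight k α (l - q) • (resolventOp k α B (n - l) * B) (u q)) := fun l hl => by
    have e := h l (Nat.lt_succ_iff.1 (Finset.mem_range.1 hl))
    rw [← Finset.sum_range_reflect, ← neg_eq_iff_eq_neg] at e
    rw [mul_apply_eq_comp, ← e, map_neg, map_add, map_sum, map_sum, neg_inj]
    congr 1
    refine Finset.sum_congr rfl fun q hq => ?_
    have := Finset.mem_range.1 hq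
    rw [map_smul, map_smul, mul_apply_eq_comp]
    rw [show l + 1 - 1 - q = l - q by omega, show l - (l - q) = q by omega]
  -- After inserting the equation for `B (g l)` and exchanging the sums, everything acting on `u q`
  -- is the coefficient identity of order `n - q`, so only `q = n` survives.
  have h2 : ∀ q ∈ Finset.range (n + 1), resolventOp k α B (n - q) (u q) +
      ∑ l ∈ Finset.Ico q (n + 1), cqWeight k α (l - q) • (resolventOp k α B (n - l) * B) (u q) =
        if q = n then u q else 0 := fun q hq => by
    have hq' := Finset.mem_range.1 hq
    have e := congrArg (fun L : H →L[ℂ] H => L (u q))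
      (resolventOp_add_sum hk1 hk6 hα0 hα1 hB (n - q))
    simp only [add_apply, sum_apply, smul_apply] at e
    rw [Finset.sum_Ico_eq_sum_range, show n + 1 - q = n - q + 1 by omega]
    simp only [Nat.add_sub_cancel_left, ← Nat.sub_sub]
    rw [e]
    by_cases hqn : q = n
    · simp [hqn]
    · rw [if_neg hqn, if_neg (by omega)]
      rfl
  have h3 := Finset.sum_Ico_Ico_comm 0 (n + 1) fun q l =>
    cqWeight k α (l - q) • (resolventOp k α B (n - l) * B) (u q)
  simp only [← Finset.range_eq_Ico] at h3
  rw [Finset.sum_congr rfl h1, Finset.sum_neg_distrib, neg_neg, Finset.sum_add_distrib, ← h3,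
    ← Finset.sum_add_distrib, Finset.sum_congr rfl h2]
  simp

end Operator

/-- Lax–Milgram: `A` is represented on `V` by an invertible `a`, and the equation reads `a u = -ι*
d`. Thus `B = ι a⁻¹ ι*`, positive because `a` is. -/
theorem exists_isPositive_solution_operator {H V : Type*} [NormedAddCommGroup H]
    [InnerProductSpace ℂ H] [CompleteSpace H] [NormedAddCommGroup V] [InnerProductSpace ℂ V]
    [CompleteSpace V] (ι : V →L[ℂ] H) (A : V →L[ℂ] (V →L⋆[ℂ] ℂ)) {β₀ β₁ : ℝ} (hβ₀ : 0 < β₀)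
    (hA : IsSelfAdjointElliptic A β₀ β₁) :
    ∃ B : H →L[ℂ] H, B.IsPositive ∧ ∀ (d : H) (u : V),
      (∀ φ : V, inner ℂ (ι φ) d + A u φ = 0) → ι u = -B d := by
  obtain ⟨a, ha⟩ : ∃ a : V →L[ℂ] V, ∀ u φ, inner ℂ (a φ) u = A u φ :=
    ⟨InnerProductSpace.continuousLinearMapOfBilin A.flip, fun u φ => by simp⟩
  have ha' : ∀ u φ, inner ℂ φ (a u) = A u φ := fun u φ => by
    rw [← inner_conj_symm, ha, ← hA.selfAdjoint]
  have hlow : ∀ u, β₀ * ‖u‖ ^ 2 ≤ (inner ℂ (a u) u).re := fun u => by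
    rw [ha]; exact hA.lower u
  have hunit : IsUnit a := by
    refine ContinuousLinearMap.isUnit_of_forall_le_norm_inner_map a (c := ⟨β₀, hβ₀.le⟩) hβ₀
      fun u => ?_
    calc ‖u‖ ^ 2 * β₀ = β₀ * ‖u‖ ^ 2 := mul_comm _ _
      _ ≤ _ := (hlow u).trans (Complex.re_le_norm _)
  obtain ⟨e, rfl⟩ := hunit
  have he : ∀ u, (e⁻¹ : (V →L[ℂ] V)ˣ).1 (e.1 u) = u := fun u => by
    rw [← mul_apply_eq_comp, ← Units.val_mul]; simp
  have he' : ∀ u, e.1 ((e⁻¹ : (V →L[ℂ] V)ˣ).1 u) = u := fun u => by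
    rw [← mul_apply_eq_comp, ← Units.val_mul]; simp
  have hpos : (e⁻¹ : (V →L[ℂ] V)ˣ).1.IsPositive := by
    rw [ContinuousLinearMap.isPositive_iff_complex]
    intro x
    obtain ⟨y, rfl⟩ : ∃ y, e.1 y = x := ⟨_, he' x⟩
    rw [he, ha']
    have h1 := hA.selfAdjoint y y
    have h2 : 0 ≤ (A y y).re := (by positivity : 0 ≤ β₀ * ‖y‖ ^ 2).trans (hA.lower y)
    exact ⟨(Complex.conj_eq_iff_re.1 h1.symm), h2⟩
  refine ⟨_, hpos.conj_adjoint ι, fun d u h => ?_⟩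
  have h1 : e.1 u = -ContinuousLinearMap.adjoint ι d := by
    refine ext_inner_left ℂ fun φ => ?_
    rw [ha', inner_neg_right, ContinuousLinearMap.adjoint_inner_right]
    exact eq_neg_of_add_eq_zero_right (h φ)
  rw [← he u, h1]
  simp

/-! ### Sums of powers -/

theorem rpow_neg_le_of_le_two_mul {x y e : ℝ} (hy : 0 < y) (he0 : 0 ≤ e)
    (he : e ≤ 2) (h : y ≤ 2 * x) : x ^ (-e) ≤ 4 * y ^ (-e) := by
  calc x ^ (-e) ≤ (y / 2) ^ (-e) :=
        Real.rpow_le_rpow_of_nonpos (by positivity) (by linarith) (by linarith)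
    _ = 2 ^ e * y ^ (-e) := by
        rw [Real.div_rpow hy.le (by norm_num), Real.rpow_neg (by norm_num : (0:ℝ) ≤ 2),
          div_inv_eq_mul, mul_comm]
    _ ≤ 4 * y ^ (-e) := by
        gcongr
        calc (2 : ℝ) ^ e ≤ 2 ^ (2 : ℝ) := Real.rpow_le_rpow_of_exponent_le (by norm_num) he
          _ = 4 := by norm_num

/-- Bernoulli's inequality for `(x / (x + 1))^a`. It replaces integral comparison: `a (x+1)^{a-1} ≤
(x+1)^a - x^a`, so the sums below telescope. -/
theorem sub_rpow_le {a x : ℝ} (ha0 : 0 ≤ a) (ha1 : a ≤ 1) (hx : 0 ≤ x) :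
    x ^ a ≤ (x + 1) ^ a * (1 - a / (x + 1)) := by
  have hx1 : 0 < x + 1 := by linarith
  have h1 : -1 ≤ -(1 / (x + 1)) := by
    rw [neg_le_neg_iff, div_le_one hx1]; linarith
  have h := rpow_one_add_le_one_add_mul_self h1 ha0 ha1
  calc x ^ a = ((x + 1) * (1 + -(1 / (x + 1)))) ^ a := by congr 1; field_simp; ring
    _ = (x + 1) ^ a * (1 + -(1 / (x + 1))) ^ a := Real.mul_rpow hx1.le (by linarith)
    _ ≤ (x + 1) ^ a * (1 + a * -(1 / (x + 1))) := by gcongr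
    _ = _ := by ring

theorem sum_rpow_sub_one_le {a : ℝ} (ha0 : 0 < a) (ha1 : a ≤ 1) (n : ℕ) :
    ∑ i ∈ Finset.range n, (i + 1 : ℝ) ^ (a - 1) ≤ (n : ℝ) ^ a / a := by
  induction n with
  | zero => simp [Real.zero_rpow ha0.ne']
  | succ n ih =>
    have hn : (0 : ℝ) ≤ n := n.cast_nonneg
    rw [Finset.sum_range_succ]
    have h := sub_rpow_le ha0.le ha1 hn
    have e : (n + 1 : ℝ) ^ (a - 1) = (n + 1 : ℝ) ^ a / (n + 1) :=
      Real.rpow_sub_one (by positivity) a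
    push_cast
    rw [le_div_iff₀ ha0] at ih ⊢
    rw [e, add_mul]
    calc _ ≤ (n + 1 : ℝ) ^ a * (1 - a / (n + 1)) + (n + 1 : ℝ) ^ a / (n + 1) * a := by
          exact add_le_add_left (ih.trans h) _
      _ = _ := by ring

theorem sum_rpow_neg_one_sub_le {α : ℝ} (hα0 : 0 < α) (hα1 : α ≤ 1) (i n : ℕ) :
    ∑ l ∈ Finset.range n, (l + 1 + i : ℝ) ^ (-(1 + α)) ≤ 2 / α * (i + 1 : ℝ) ^ (-α) := by
  have hstep : ∀ x : ℝ, 1 ≤ x → x ^ (-(1 + α)) ≤ 2 / α * (x ^ (-α) - (x + 1) ^ (-α)) := by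
    intro x hx
    have hx0 : 0 < x := by linarith
    have h := sub_rpow_le hα0.le hα1 hx0.le
    have p1 : 0 < x ^ α := by positivity
    have p2 : 0 < (x + 1) ^ α := by positivity
    have h' : (x + 1) ^ (-α) ≤ x ^ (-α) * (1 - α / (x + 1)) := by
      rw [Real.rpow_neg hx0.le, Real.rpow_neg (by linarith), inv_mul_eq_div,
        le_div_iff₀ p1, inv_mul_eq_div, div_le_iff₀ p2, mul_comm]
      exact h
    have e : x ^ (-(1 + α)) = x ^ (-α) / x := by
      rw [neg_add', ← Real.rpow_sub_one hx0.ne']; ring_nf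
    calc x ^ (-(1 + α)) = 2 / α * (x ^ (-α) * (α / (2 * x))) := by rw [e]; field_simp
      _ ≤ 2 / α * (x ^ (-α) * (α / (x + 1))) := by gcongr; linarith
      _ ≤ _ := by gcongr; linarith
  have key : ∑ l ∈ Finset.range n, (l + 1 + i : ℝ) ^ (-(1 + α)) ≤
      2 / α * ((i + 1 : ℝ) ^ (-α) - (n + 1 + i : ℝ) ^ (-α)) := by
    induction n with
    | zero => simp [add_comm]
    | succ n ih =>
      rw [Finset.sum_range_succ]
      have h := hstep (n + 1 + i) (by
        have : (0 : ℝ) ≤ n := n.cast_nonneg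
        have : (0 : ℝ) ≤ i := i.cast_nonneg
        linarith)
      push_cast
      rw [show (n + 1 + 1 + i : ℝ) = n + 1 + i + 1 by ring]
      linarith
  refine key.trans ?_
  gcongr
  exact sub_le_self _ (by positivity)

theorem sum_range_sub_rpow (a : ℝ) (n : ℕ) :
    ∑ l ∈ Finset.range (n + 1), ((n - l : ℕ) + 1 : ℝ) ^ a =
      ∑ l ∈ Finset.range (n + 1), (l + 1 : ℝ) ^ a :=
  Finset.sum_flip (fun l : ℕ => (l + 1 : ℝ) ^ a)

/-- The convolution of the solution operator with the tail of the quadrature weights. -/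
theorem sum_rpow_mul_rpow_le {α : ℝ} (hα0 : 0 < α) (hα1 : α < 1) (i n : ℕ) :
    ∑ l ∈ Finset.range (n + 1),
      ((n - l : ℕ) + 1 : ℝ) ^ (α - 1) * (l + 1 + i : ℝ) ^ (-(1 + α)) ≤
        12 / α * (n + 1 : ℝ) ^ (α - 1) * (i + 1 : ℝ) ^ (-α) := by
  have hn : (0 : ℝ) ≤ n := n.cast_nonneg
  have hi : (0 : ℝ) ≤ i := i.cast_nonneg
  have hterm : ∀ l ∈ Finset.range (n + 1),
      ((n - l : ℕ) + 1 : ℝ) ^ (α - 1) * (l + 1 + i : ℝ) ^ (-(1 + α)) ≤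
        4 * (n + 1 : ℝ) ^ (α - 1) * (l + 1 + i : ℝ) ^ (-(1 + α)) +
          4 * (n + 1 + i : ℝ) ^ (-(1 + α)) * ((n - l : ℕ) + 1 : ℝ) ^ (α - 1) := fun l hl => by
    have hl' : l ≤ n := Nat.lt_succ_iff.1 (Finset.mem_range.1 hl)
    have hl0 : (0 : ℝ) ≤ l := l.cast_nonneg
    have hln : (l : ℝ) ≤ n := by exact_mod_cast hl'
    -- Either `n - l + 1 ≥ (n + 1) / 2`, and the first factor is comparable to its value at `l = 0`,
    -- or `l + 1 + i ≥ (n + 1 + i) / 2`, and the second is comparable to its value at `l = n`.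
    rcases le_total (n + 1 : ℝ) (2 * ((n - l : ℕ) + 1)) with h | h
    · refine le_add_of_le_of_nonneg ?_ (by positivity)
      gcongr
      have := rpow_neg_le_of_le_two_mul (e := 1 - α) (by positivity) (by linarith)
        (by linarith) h
      simpa using this
    · refine le_add_of_nonneg_of_le (by positivity) ?_
      rw [mul_comm]
      gcongr
      refine rpow_neg_le_of_le_two_mul (by positivity) (by linarith)
        (by linarith) ?_
      rw [Nat.cast_sub hl'] at h
      linarith
  have h1 := sum_rpow_neg_one_sub_le hα0 hα1.le i (n + 1)
  have h2 := sum_rpow_sub_one_le hα0 hα1.le (n + 1)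
  push_cast at h2
  have h3 : (n + 1 + i : ℝ) ^ (-(1 + α)) ≤ (n + 1 : ℝ)⁻¹ * (i + 1 : ℝ) ^ (-α) := by
    rw [neg_add, Real.rpow_add (by positivity), Real.rpow_neg_one]
    exact mul_le_mul (inv_anti₀ (by positivity) (by linarith))
      (Real.rpow_le_rpow_of_nonpos (by positivity) (by linarith) (by linarith))
      (by positivity) (by positivity)
  calc _ ≤ 4 * (n + 1 : ℝ) ^ (α - 1) *
          (∑ l ∈ Finset.range (n + 1), (l + 1 + i : ℝ) ^ (-(1 + α))) +
        4 * (n + 1 + i : ℝ) ^ (-(1 + α)) *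
          ∑ l ∈ Finset.range (n + 1), (l + 1 : ℝ) ^ (α - 1) := by
        rw [← sum_range_sub_rpow, Finset.mul_sum, Finset.mul_sum, ← Finset.sum_add_distrib]
        exact Finset.sum_le_sum hterm
    _ ≤ 4 * (n + 1 : ℝ) ^ (α - 1) * (2 / α * (i + 1 : ℝ) ^ (-α)) +
        4 * ((n + 1 : ℝ)⁻¹ * (i + 1 : ℝ) ^ (-α)) * ((n + 1 : ℝ) ^ α / α) := by gcongr
    _ = _ := by
        rw [Real.rpow_sub_one (by positivity)]
        field_simp
        ring

/-- A discrete Beta integral: the exponents add up to `-1` and each exceeds `-1`, so the bound does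
not grow with `n`, not even logarithmically. The sum is split at its middle. -/
theorem sum_rpow_neg_mul_rpow_sub_one_le {α : ℝ} (hα0 : 0 < α) (hα1 : α < 1) (n : ℕ) :
    ∑ i ∈ Finset.range (n + 1), (i + 1 : ℝ) ^ (-α) * ((n - i : ℕ) + 1 : ℝ) ^ (α - 1) ≤
      4 / (1 - α) + 4 / α := by
  have hn : (0 : ℝ) ≤ n := n.cast_nonneg
  have hα : 0 < 1 - α := by linarith
  have hterm : ∀ i ∈ Finset.range (n + 1),
      (i + 1 : ℝ) ^ (-α) * ((n - i : ℕ) + 1 : ℝ) ^ (α - 1) ≤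
        4 * (n + 1 : ℝ) ^ (α - 1) * (i + 1 : ℝ) ^ (-α) +
          4 * (n + 1 : ℝ) ^ (-α) * ((n - i : ℕ) + 1 : ℝ) ^ (α - 1) := fun i hi => by
    have hi' : i ≤ n := Nat.lt_succ_iff.1 (Finset.mem_range.1 hi)
    rcases le_total (n + 1 : ℝ) (2 * ((n - i : ℕ) + 1)) with h | h
    · refine le_add_of_le_of_nonneg ?_ (by positivity)
      rw [mul_comm]
      gcongr
      have := rpow_neg_le_of_le_two_mul (e := 1 - α) (by positivity) (by linarith)
        (by linarith) h
      simpa using this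
    · refine le_add_of_nonneg_of_le (by positivity) ?_
      gcongr
      refine rpow_neg_le_of_le_two_mul (by positivity) hα0.le
        (by linarith) ?_
      rw [Nat.cast_sub hi'] at h
      linarith
  have h1 := sum_rpow_sub_one_le hα (by linarith) (n + 1)
  have h2 := sum_rpow_sub_one_le hα0 hα1.le (n + 1)
  push_cast at h1 h2
  rw [show 1 - α - 1 = -α by ring] at h1
  calc _ ≤ 4 * (n + 1 : ℝ) ^ (α - 1) * (∑ i ∈ Finset.range (n + 1), (i + 1 : ℝ) ^ (-α)) +
        4 * (n + 1 : ℝ) ^ (-α) * ∑ i ∈ Finset.range (n + 1), (i + 1 : ℝ) ^ (α - 1) := by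
        rw [← sum_range_sub_rpow (α - 1), Finset.mul_sum, Finset.mul_sum,
          ← Finset.sum_add_distrib]
        exact Finset.sum_le_sum hterm
    _ ≤ 4 * (n + 1 : ℝ) ^ (α - 1) * ((n + 1 : ℝ) ^ (1 - α) / (1 - α)) +
        4 * (n + 1 : ℝ) ^ (-α) * ((n + 1 : ℝ) ^ α / α) := by gcongr
    _ = _ := by
        have e1 : (n + 1 : ℝ) ^ (α - 1) * (n + 1 : ℝ) ^ (1 - α) = 1 := by
          rw [← Real.rpow_add (by positivity)]; simp
        have e2 : (n + 1 : ℝ) ^ (-α) * (n + 1 : ℝ) ^ α = 1 := by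
          rw [← Real.rpow_add (by positivity)]; simp
        linear_combination (4 / (1 - α)) * e1 + (4 / α) * e2

/-! ### The iteration -/

/-- The series is finite because `W` vanishes in the past. Time `0` (`i = 0`) is counted as history,
so the first sum involves only the unknowns at positive times. -/
theorem cqDeriv_eq_sum {H : Type*} [NormedAddCommGroup H] [InnerProductSpace ℂ H] (k : ℕ)
    (α τ : ℝ) {W : ℤ → H} {N : ℕ} (hW : ∀ n : ℤ, n ≤ -(N : ℤ) → W n = 0) (n : ℕ) :
    cqDeriv k α τ W n = (((τ ^ α)⁻¹ : ℝ) : ℂ) •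
      (∑ j ∈ Finset.range n, cqWeight k α j • W (n - j : ℤ) +
        ∑ i ∈ Finset.range N, cqWeight k α (n + i) • W (-(i : ℤ))) := by
  rw [cqDeriv, tsum_eq_sum (s := Finset.range (n + N)), Finset.sum_range_add]
  · congr 2
    refine Finset.sum_congr rfl fun i _ => ?_
    rw [Nat.cast_add, sub_add_cancel_left]
  · intro j hj
    rw [hW _ (by simp at hj; omega), smul_zero]

/-- The weighted norm of the `m`-th iterate in which the iteration contracts. -/
noncomputable def historyNorm {H : Type*} [NormedAddCommGroup H] (α : ℝ) (N : ℕ) (W : ℤ → H) :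
    ℝ :=
  ∑ i ∈ Finset.range N, (i + 1 : ℝ) ^ (-α) * ‖W ((N : ℤ) - i)‖

theorem historyNorm_nonneg {H : Type*} [NormedAddCommGroup H] (α : ℝ) (N : ℕ) (W : ℤ → H) :
    0 ≤ historyNorm α N W := Finset.sum_nonneg fun _ _ => by positivity

theorem exists_norm_iterate_le {k : ℕ} (hk1 : 1 ≤ k) (hk6 : k ≤ 6) {α : ℝ} (hα0 : 0 < α)
    (hα1 : α < 1) : ∃ C : ℝ, 0 < C ∧
      ∀ (H : Type*) [NormedAddCommGroup H] [InnerProductSpace ℂ H] [CompleteSpace H]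
        (V : Type*) [NormedAddCommGroup V] [InnerProductSpace ℂ V] [CompleteSpace V]
        (ι : V →L[ℂ] H) (A : V →L[ℂ] (V →L⋆[ℂ] ℂ)) (β₀ β₁ : ℝ) (_ : 0 < β₀)
        (_ : IsSelfAdjointElliptic A β₀ β₁) (N : ℕ) (τ : ℝ) (_ : 0 < τ) (κ : ℝ) (_ : 0 < κ)
        (U : ℕ → ℤ → H)
        (_ : IsCQIteration ι A k α τ N κ (0 : H) (fun _ => (0 : V →L⋆[ℂ] ℂ)) U)
        (m n : ℕ) (_ : n < N),
        ‖U (m + 1) ((n + 1 : ℕ) : ℤ)‖ ≤ C * κ * (n + 1 : ℝ) ^ (α - 1) *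
          (historyNorm α N (U (m + 1)) + historyNorm α N (U m)) := by
  obtain ⟨C₁, hC₁, h₁⟩ := exists_norm_cqWeight_le hk1 hk6 hα0 hα1
  obtain ⟨C₂, hC₂, h₂⟩ := exists_norm_resolventOp_mul_le hk1 hk6 hα0 hα1
  refine ⟨C₁ * C₂ * (12 / α), by positivity, ?_⟩
  intro H _ _ _ V _ _ _ ι A β₀ β₁ hβ₀ hA N τ hτ κ hκ U hU m n hn
  obtain ⟨B, hB, hBsol⟩ := exists_isPositive_solution_operator ι A hβ₀ hA
  have hB' : ((((τ ^ α)⁻¹ : ℝ) : ℂ) • B).IsPositive :=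
    hB.smul_of_nonneg (by rw [Complex.zero_le_real]; positivity)
  have hm1 : 1 ≤ m + 1 := Nat.le_add_left 1 m
  obtain ⟨g, hg⟩ : ∃ g : ℕ → H, ∀ l, g l = ∑ i ∈ Finset.range N,
      cqWeight k α (l + 1 + i) • U (m + 1) (-(i : ℤ)) := ⟨_, fun _ => rfl⟩
  -- Index `l` stands for the time level `l + 1`; the factor `τ^{-α}` is absorbed into the positive
  -- operator, over which the resolvent bound is uniform.
  have hvolterra : ∀ l ≤ n, U (m + 1) ((l + 1 : ℕ) : ℤ) + ((((τ ^ α)⁻¹ : ℝ) : ℂ) • B)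
      (∑ j ∈ Finset.range (l + 1), cqWeight k α j • U (m + 1) ((l - j + 1 : ℕ) : ℤ)) =
        -((((τ ^ α)⁻¹ : ℝ) : ℂ) • B) (g l) := fun l hl => by
    obtain ⟨u, hu, hsch⟩ := hU.scheme (m + 1) hm1 (l + 1) (by omega) (by omega)
    have e := hBsol _ u hsch
    rw [hu, cqDeriv_eq_sum k α τ (hU.past (m + 1) hm1), ← hg, map_smul, map_add] at e
    have hidx : ∑ j ∈ Finset.range (l + 1), cqWeight k α j • U (m + 1) ((l - j + 1 : ℕ) : ℤ) =
        ∑ j ∈ Finset.range (l + 1), cqWeight k α j • U (m + 1) ((l + 1 : ℕ) - j : ℤ) := by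
      refine Finset.sum_congr rfl fun j hj => ?_
      have := Finset.mem_range.1 hj
      congr 2
      omega
    rw [hidx, e, smul_apply, smul_apply, smul_add]
    abel
  have hsol := eq_sum_resolventOp hk1 hk6 hα0 hα1 hB'
    (u := fun l => U (m + 1) ((l + 1 : ℕ) : ℤ)) hvolterra
  obtain ⟨d, hd⟩ : ∃ d : ℕ → ℝ, ∀ i, d i =
      ‖U (m + 1) ((N : ℤ) - i)‖ + ‖U m ((N : ℤ) - i)‖ := ⟨_, fun _ => rfl⟩
  have hd0 : ∀ i, 0 ≤ d i := fun i => by rw [hd]; positivity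
  have hhist : ∀ i ∈ Finset.range N, ‖U (m + 1) (-(i : ℤ))‖ ≤ κ * d i := fun i hi => by
    rw [hU.history (m + 1) hm1 i (Finset.mem_range.1 hi), zero_add, norm_smul, Complex.norm_real,
      Real.norm_of_nonneg hκ.le, Nat.add_sub_cancel, hd]
    gcongr
    exact norm_sub_le _ _
  have hgl : ∀ l, ‖g l‖ ≤ ∑ i ∈ Finset.range N,
      C₁ * (l + 1 + i : ℝ) ^ (-(1 + α)) * (κ * d i) := fun l => by
    rw [hg]
    refine (norm_sum_le _ _).trans (Finset.sum_le_sum fun i hi => ?_)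
    rw [norm_smul]
    have := h₁ (l + 1 + i) (by omega)
    rw [← neg_add' 1 α] at this
    push_cast at this
    exact mul_le_mul this (hhist i hi) (norm_nonneg _) (by positivity)
  rw [hsol, norm_neg]
  calc _ ≤ ∑ l ∈ Finset.range (n + 1), C₂ * ((n - l : ℕ) + 1 : ℝ) ^ (α - 1) *
          ∑ i ∈ Finset.range N, C₁ * (l + 1 + i : ℝ) ^ (-(1 + α)) * (κ * d i) := by
        refine (norm_sum_le _ _).trans (Finset.sum_le_sum fun l _ => ?_)
        exact (ContinuousLinearMap.le_opNorm _ _).trans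
          (mul_le_mul (h₂ H _ hB' _) (hgl l) (norm_nonneg _) (by positivity))
    _ = ∑ i ∈ Finset.range N, C₁ * C₂ * κ * d i * ∑ l ∈ Finset.range (n + 1),
          ((n - l : ℕ) + 1 : ℝ) ^ (α - 1) * (l + 1 + i : ℝ) ^ (-(1 + α)) := by
        simp only [Finset.mul_sum]
        rw [Finset.sum_comm]
        exact Finset.sum_congr rfl fun i _ => Finset.sum_congr rfl fun l _ => by ring
    _ ≤ ∑ i ∈ Finset.range N, C₁ * C₂ * κ * d i *
          (12 / α * (n + 1 : ℝ) ^ (α - 1) * (i + 1 : ℝ) ^ (-α)) := by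
        refine Finset.sum_le_sum fun i _ => ?_
        have := hd0 i
        gcongr
        exact sum_rpow_mul_rpow_le hα0 hα1 i n
    _ = _ := by
        rw [historyNorm, historyNorm, ← Finset.sum_add_distrib, Finset.mul_sum]
        refine Finset.sum_congr rfl fun i _ => ?_
        rw [hd]
        ring

theorem historyNorm_le {H : Type*} [NormedAddCommGroup H] {α : ℝ} (hα0 : 0 < α) (hα1 : α < 1)
    {N : ℕ} {W : ℤ → H} {M : ℝ} (hM : 0 ≤ M)
    (h : ∀ n : ℕ, n < N → ‖W ((n + 1 : ℕ) : ℤ)‖ ≤ M * (n + 1 : ℝ) ^ (α - 1)) :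
    historyNorm α N W ≤ (4 / (1 - α) + 4 / α) * M := by
  have hα : 0 < 1 - α := by linarith
  rcases N with _ | N
  · simp only [historyNorm, Finset.range_zero, Finset.sum_empty]
    positivity
  calc historyNorm α (N + 1) W ≤ ∑ i ∈ Finset.range (N + 1),
        M * ((i + 1 : ℝ) ^ (-α) * ((N - i : ℕ) + 1 : ℝ) ^ (α - 1)) := by
        refine Finset.sum_le_sum fun i hi => ?_
        have hi' := Finset.mem_range.1 hi
        rw [mul_left_comm, show ((N + 1 : ℕ) : ℤ) - i = ((N - i + 1 : ℕ) : ℤ) by omega]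
        gcongr
        exact h (N - i) (by omega)
    _ ≤ M * (4 / (1 - α) + 4 / α) := by
        rw [← Finset.mul_sum]
        gcongr
        exact sum_rpow_neg_mul_rpow_sub_one_le hα0 hα1 N
    _ = _ := mul_comm _ _

/-- The passage from indices to times is free, since `τ^{α-1} · τ · τ^{-α} = 1`. -/
theorem rpow_mul_historyNorm {H : Type*} [NormedAddCommGroup H] {α τ : ℝ} (hτ : 0 < τ) (N : ℕ)
    (W : ℤ → H) {x : ℝ} (hx : 0 ≤ x) :
    x ^ (α - 1) * historyNorm α N W = (x * τ) ^ (α - 1) *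
      (τ * ∑ j ∈ Finset.Icc 1 N, ((j : ℝ) * τ) ^ (-α) * ‖W ((N : ℤ) - (j : ℤ) + 1)‖) := by
  have e : ∑ j ∈ Finset.Icc 1 N, ((j : ℝ) * τ) ^ (-α) * ‖W ((N : ℤ) - (j : ℤ) + 1)‖ =
      τ ^ (-α) * historyNorm α N W := by
    rw [← Finset.Ico_add_one_right_eq_Icc, Finset.sum_Ico_eq_sum_range, Nat.add_sub_cancel,
      historyNorm, Finset.mul_sum]
    refine Finset.sum_congr rfl fun i _ => ?_
    rw [Real.mul_rpow (by positivity) hτ.le, add_comm 1 i]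
    push_cast
    rw [sub_add_eq_sub_sub, sub_add_cancel]
    ring
  have hτ1 : τ ^ (α - 1) * (τ * τ ^ (-α)) = 1 := by
    rw [mul_comm τ, ← Real.rpow_add_one hτ.ne', ← Real.rpow_add hτ,
      show α - 1 + (-α + 1) = 0 by ring, Real.rpow_zero]
  rw [e, Real.mul_rpow hx hτ.le]
  linear_combination (-(x ^ (α - 1) * historyNorm α N W)) * hτ1

theorem lemma3 (k : ℕ) (hk1 : 1 ≤ k) (hk6 : k ≤ 6) (α : ℝ) (hα0 : 0 < α) (hα1 : α < 1)
    (T : ℝ) (hT : 0 < T) (β₀ : ℝ) (hβ₀ : 0 < β₀) :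
    ∃ C c : ℝ, 0 < C ∧ 0 < c ∧
      ∀ κ₀ : ℝ, 0 < κ₀ → C * κ₀ < 1 / 2 →
      ∃ γ : ℝ, γ = C * κ₀ / (1 - C * κ₀) ∧ 0 < γ ∧ γ < 1 ∧
        ∀ (H : Type*) [NormedAddCommGroup H] [InnerProductSpace ℂ H] [CompleteSpace H]
          (V : Type*) [NormedAddCommGroup V] [InnerProductSpace ℂ V] [CompleteSpace V]
          (ι : V →L[ℂ] H) (_ : IsGelfandEmbedding ι)
          (A : V →L[ℂ] (V →L⋆[ℂ] ℂ)) (β₁ : ℝ) (_ : β₀ < β₁)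
          (_ : IsSelfAdjointElliptic A β₀ β₁)
          (N : ℕ) (_ : 2 ≤ N) (τ : ℝ) (_ : τ = T / N) (κ : ℝ) (_ : κ = κ₀ / Real.log N)
          (U : ℕ → ℤ → H)
          (_ : IsCQIteration ι A k α τ N κ (0 : H) (fun _ => (0 : V →L⋆[ℂ] ℂ)) U)
          (m : ℕ) (_ : 1 ≤ m) (n : ℕ) (_ : 1 ≤ n) (_ : n ≤ N),
          ‖U m (n : ℤ)‖ ≤ c * ((n : ℝ) * τ) ^ (α - 1) * γ ^ m *
            (τ * ∑ j ∈ Finset.Icc 1 N,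
              ((j : ℝ) * τ) ^ (-α) * ‖U 0 ((N : ℤ) - (j : ℤ) + 1)‖) := by
  obtain ⟨C₀, hC₀, h₀⟩ := exists_norm_iterate_le hk1 hk6 hα0 hα1
  have hα : 0 < 1 - α := by linarith
  have hlog2 : 0 < Real.log 2 := Real.log_pos one_lt_two
  obtain ⟨Q, hQ⟩ : ∃ Q, Q = 4 / (1 - α) + 4 / α := ⟨_, rfl⟩
  have hQ0 : 0 < Q := by rw [hQ]; positivity
  -- `Q` is the Beta bound, and `Q + 1` lets one constant control both `C₀ κ Q` and `C₀ κ`. The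
  -- divisor comes from `κ ≤ κ₀ / log 2`, valid as `N ≥ 2`.
  obtain ⟨C, hC⟩ : ∃ C, C = C₀ * (Q + 1) / Real.log 2 := ⟨_, rfl⟩
  have hC0 : 0 < C := by rw [hC]; positivity
  refine ⟨C, 1, hC0, one_pos, fun κ₀ hκ₀ hCκ => ⟨C * κ₀ / (1 - C * κ₀), rfl, ?_, ?_, ?_⟩⟩
  · have := mul_pos hC0 hκ₀
    exact div_pos this (by linarith)
  · rw [div_lt_one (by linarith)]
    linarith
  intro H _ _ _ V _ _ _ ι _ A β₁ _ hA N hN τ hτ κ hκ U hU m hm n hn hnN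
  obtain ⟨x, hx⟩ : ∃ x, x = C * κ₀ := ⟨_, rfl⟩
  have hx0 : 0 < x := by rw [hx]; exact mul_pos hC0 hκ₀
  rw [← hx] at hCκ ⊢
  have hx1 : 0 < 1 - x := by linarith
  obtain ⟨γ, hγ⟩ : ∃ γ, γ = x / (1 - x) := ⟨_, rfl⟩
  have hγ0 : 0 < γ := by rw [hγ]; positivity
  have hγx : x * (γ + 1) = γ := by rw [hγ]; field_simp; ring
  rw [← hγ]
  have hN0 : (0 : ℝ) < N := by exact_mod_cast (by omega : 0 < N)
  have hlog : Real.log 2 ≤ Real.log N := Real.log_le_log two_pos (by exact_mod_cast hN)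
  have hτ0 : 0 < τ := by rw [hτ]; positivity
  have hκ0 : 0 < κ := by rw [hκ]; exact div_pos hκ₀ (hlog2.trans_le hlog)
  have hκle : C₀ * κ * (Q + 1) ≤ x := by
    rw [hx, hC, hκ]
    calc C₀ * (κ₀ / Real.log N) * (Q + 1) ≤ C₀ * (κ₀ / Real.log 2) * (Q + 1) := by gcongr
      _ = _ := by ring
  have hS := fun m => historyNorm_nonneg α N (U m)
  have hpt : ∀ m n : ℕ, n < N → ‖U (m + 1) ((n + 1 : ℕ) : ℤ)‖ ≤
      C₀ * κ * (historyNorm α N (U (m + 1)) + historyNorm α N (U m)) * (n + 1 : ℝ) ^ (α - 1) :=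
    fun m n hn => (h₀ H V ι A β₀ β₁ hβ₀ hA N τ hτ0 κ hκ0 U hU m n hn).trans_eq (by ring)
  have hcontract : ∀ m, historyNorm α N (U (m + 1)) ≤ γ * historyNorm α N (U m) := fun m => by
    have hM : 0 ≤ C₀ * κ * (historyNorm α N (U (m + 1)) + historyNorm α N (U m)) :=
      mul_nonneg (by positivity) (add_nonneg (hS _) (hS _))
    have h := historyNorm_le hα0 hα1 hM (hpt m)
    rw [← hQ] at h
    have h' : historyNorm α N (U (m + 1)) ≤
        x * (historyNorm α N (U (m + 1)) + historyNorm α N (U m)) := by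
      refine h.trans ?_
      have := add_nonneg (hS (m + 1)) (hS m)
      calc Q * (C₀ * κ * (historyNorm α N (U (m + 1)) + historyNorm α N (U m)))
          ≤ (C₀ * κ * (Q + 1)) * (historyNorm α N (U (m + 1)) + historyNorm α N (U m)) := by
            nlinarith
        _ ≤ _ := by gcongr
    -- The scheme is implicit in its own history, so the new norm also stands on the right; it is
    -- absorbed using `x < 1`.
    rw [hγ, div_mul_eq_mul_div, le_div_iff₀ hx1]
    linarith
  have hpow : ∀ m, historyNorm α N (U m) ≤ γ ^ m * historyNorm α N (U 0) := fun m => by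
    induction m with
    | zero => simp
    | succ m ih =>
      refine (hcontract m).trans ?_
      rw [pow_succ', mul_assoc]
      gcongr
  obtain ⟨m, rfl⟩ := Nat.exists_eq_add_of_le' hm
  obtain ⟨n, rfl⟩ := Nat.exists_eq_add_of_le' hn
  -- The identity `x (γ + 1) = γ` turns the sum of the two history norms into one further power of
  -- `γ`, which is why the final constant `c` can be `1`.
  have hcoef : C₀ * κ * (historyNorm α N (U (m + 1)) + historyNorm α N (U m)) ≤
      γ ^ (m + 1) * historyNorm α N (U 0) := by
    have h1 : C₀ * κ ≤ x := le_trans (le_mul_of_one_le_right (by positivity) (by linarith)) hκle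
    calc C₀ * κ * (historyNorm α N (U (m + 1)) + historyNorm α N (U m))
        ≤ x * (γ * historyNorm α N (U m) + historyNorm α N (U m)) :=
          mul_le_mul h1 (by gcongr; exact hcontract m) (add_nonneg (hS _) (hS _)) hx0.le
      _ = γ * historyNorm α N (U m) := by linear_combination historyNorm α N (U m) * hγx
      _ ≤ γ * (γ ^ m * historyNorm α N (U 0)) := by gcongr; exact hpow m
      _ = _ := by rw [pow_succ']; ring
  have hfin := rpow_mul_historyNorm (α := α) hτ0 N (U 0) (x := ((n + 1 : ℕ) : ℝ)) (by positivity)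
  calc ‖U (m + 1) ((n + 1 : ℕ) : ℤ)‖
      ≤ C₀ * κ * (historyNorm α N (U (m + 1)) + historyNorm α N (U m)) *
          (n + 1 : ℝ) ^ (α - 1) := hpt m n (by omega)
    _ ≤ γ ^ (m + 1) * historyNorm α N (U 0) * (n + 1 : ℝ) ^ (α - 1) := by gcongr
    _ = γ ^ (m + 1) * (((n + 1 : ℕ) : ℝ) ^ (α - 1) * historyNorm α N (U 0)) := by
        push_cast; ring
    _ = _ := by rw [hfin]; ring
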